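/- Work in the smooth category. Let $K\subset S^3=\partial B^4$ be a knot, i.e. the image of a smooth embedding of the circle, and let $\Sigma_0,\Sigma_1\subset B^4$ be smooth, compact, properly embedded surfaces (they meet $S^3$ transversely and exactly in their boundary), both with boundary $K$. An ambient isotopy of $B^4$ is a smooth family $F_t$, $t\in[0,1]$, of diffeomorphisms of $B^4$ with $F_0=\mathrm{id}$; it carries $\Sigma_0$ to $\Sigma_1$ if $F_1(\Sigma_0)=\Sigma_1$, and it is rel boundary if every $F_t$ fixes $S^3$ pointwise. (1) Suppose that $F_t$ is an ambient isotopy of $B^4$ carrying $\Sigma_0$ to $\Sigma_1$, and let $f_1=F_1|_{S^3}$ be the induced diffeomorphism of the pair $(S^3,K)$. If $f_1$ is isotopic to the identity through diffeomorphisms of the pair $(S^3,K)$ (that is, through diffeomorphisms $g$ of $S^3$ with $g(K)=K$), then $\Sigma_0$ and $\Sigma_1$ are ambiently isotopic rel boundary, i.e. there is an ambient isotopy of $B^4$ rel boundary carrying $\Sigma_0$ to $\Sigma_1$. (2) In particular, let $\operatorname{Sym}(K)$ be the quotient of the group $\operatorname{Diff}(S^3,K)$ of diffeomorphisms of $S^3$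 that fix $K$ setwise by the normal subgroup of those isotopic to the identity through diffeomorphisms of the pair $(S^3,K)$. If $\operatorname{Sym}(K)$ is trivial and $\Sigma_0$ and $\Sigma_1$ are ambiently isotopic, then they are ambiently isotopic rel boundary. -/

import Mathlib

open Set Metric
open scoped Manifold ContDiff

noncomputable section

namespace KnottedSurface

/-- Euclidean `4`-space. -/
abbrev E4 : Type := EuclideanSpace ℝ (Fin 4)

/-- The closed unit ball `B⁴` in Euclidean `4`-space. -/
abbrev B4 : Set E4 := closedBall (0 : E4) 1

/-- The unit sphere `S³`, with the smooth structure that Mathlib puts on it. -/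
abbrev S3 : Type := sphere (0 : E4) 1

/-- A knot in `S³`: the image of a smooth embedding of the circle. -/
def IsKnot (K : Set S3) : Prop :=
  ∃ γ : Circle → S3, Manifold.IsSmoothEmbedding (𝓡 1) (𝓡 3) ∞ γ ∧ range γ = K

/-- A local diffeomorphism of `ℝ⁴`: a homeomorphism between open subsets of `ℝ⁴` that is smooth
together with its inverse. -/
def IsSmoothChart (φ : OpenPartialHomeomorph E4 E4) : Prop :=
  ContDiffOn ℝ ∞ φ φ.source ∧ ContDiffOn ℝ ∞ φ.symm φ.target

/-- A smooth, compact, properly embedded surface in `B⁴`. Near a point of the open ball, the subset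
`S` is a plane in suitable smooth coordinates of `ℝ⁴`; near a point of `S³`, there are smooth
coordinates in which `B⁴` is the half-space `x₀ ≥ 0` and `S` is the half-plane
`x₀ ≥ 0, x₂ = x₃ = 0`. So `S` is a smooth surface with boundary `∂S = S ∩ S³`, and it meets
`S³` transversely. The surface may be disconnected or non-orientable. -/
structure IsProperSurface (S : Set E4) : Prop where
  subset_ball : S ⊆ B4
  isCompact : IsCompact S
  interior_chart : ∀ p ∈ S, ‖p‖ < 1 → ∃ φ : OpenPartialHomeomorph E4 E4,
    IsSmoothChart φ ∧ p ∈ φ.source ∧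
      ∀ x ∈ φ.source, x ∈ S ↔ φ x 2 = 0 ∧ φ x 3 = 0
  boundary_chart : ∀ p ∈ S, ‖p‖ = 1 → ∃ φ : OpenPartialHomeomorph E4 E4,
    IsSmoothChart φ ∧ p ∈ φ.source ∧
      (∀ x ∈ φ.source, x ∈ B4 ↔ 0 ≤ φ x 0) ∧
      ∀ x ∈ φ.source, x ∈ S ↔ 0 ≤ φ x 0 ∧ φ x 2 = 0 ∧ φ x 3 = 0

/-- The properly embedded surface `S` in `B⁴` is bounded by `K`, that is, `∂S = S ∩ S³ = K`. -/
def BoundedBy (S : Set E4) (K : Set S3) : Prop :=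
  ∀ x : S3, (x : E4) ∈ S ↔ x ∈ K

/-- A smooth ambient isotopy of `B⁴`: a smooth family of diffeomorphisms of `B⁴`, parametrized by
`t ∈ [0,1]`, that starts at the identity. The family of the inverses is part of the data; only
the values at `(t, x) ∈ [0,1] × B⁴` matter. -/
structure BallIsotopy where
  /-- The diffeomorphism at time `t`. -/
  toFun : ℝ → E4 → E4
  /-- The inverse diffeomorphism at time `t`. -/
  invFun : ℝ → E4 → E4
  mapsTo : ∀ t ∈ Icc (0 : ℝ) 1, MapsTo (toFun t) B4 B4
  mapsTo_inv : ∀ t ∈ Icc (0 : ℝ) 1, MapsTo (invFun t) B4 B4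
  left_inv : ∀ t ∈ Icc (0 : ℝ) 1, LeftInvOn (invFun t) (toFun t) B4
  right_inv : ∀ t ∈ Icc (0 : ℝ) 1, RightInvOn (invFun t) (toFun t) B4
  smooth : ContDiffOn ℝ ∞ (fun p : ℝ × E4 => toFun p.1 p.2) (Icc (0 : ℝ) 1 ×ˢ B4)
  smooth_inv : ContDiffOn ℝ ∞ (fun p : ℝ × E4 => invFun p.1 p.2) (Icc (0 : ℝ) 1 ×ˢ B4)
  map_zero : ∀ x ∈ B4, toFun 0 x = x

/-- A smooth map of `B⁴` to itself with a smooth left inverse maps the open ball to itself. -/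
theorem norm_lt_one_of_leftInvOn {f g : E4 → E4} (hf : ContDiffOn ℝ ∞ f B4)
    (hg : ContDiffOn ℝ ∞ g B4) (hfm : MapsTo f B4 B4) (hgf : LeftInvOn g f B4)
    {x : E4} (hx : ‖x‖ < 1) : ‖f x‖ < 1 := by
  have hxB : x ∈ B4 := by simpa using hx.le
  have hN : B4 ∈ nhds x :=
    Filter.mem_of_superset (isOpen_ball.mem_nhds (by simpa using hx : x ∈ ball (0 : E4) 1))
      ball_subset_closedBall
  have hle : ∀ z ∈ B4, ‖f z‖ ≤ 1 := fun z hz => by simpa using hfm hz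
  refine lt_of_le_of_ne (hle x hxB) fun h1 => ?_
  have hf' : HasFDerivAt f (fderiv ℝ f x) x :=
    ((hf.contDiffAt hN).differentiableAt (by simp)).hasFDerivAt
  have hg' : HasFDerivWithinAt g (fderivWithin ℝ g B4 (f x)) B4 (f x) :=
    (hg.differentiableOn (by simp) _ (hfm hxB)).hasFDerivWithinAt
  have hcomp := hg'.comp_hasFDerivAt x hf' (Filter.mem_of_superset hN fun z hz => hfm hz)
  have hid : HasFDerivAt (g ∘ f) (ContinuousLinearMap.id ℝ E4) x :=
    (hasFDerivAt_id x).congr_of_eventuallyEq (Filter.mem_of_superset hN fun z hz => hgf hz)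
  have heq := hcomp.unique hid
  have hmax : IsLocalMax (fun z => inner ℝ (f x) (f z)) x := by
    refine Filter.mem_of_superset hN fun z hz => ?_
    have h2 : inner ℝ (f x) (f z) ≤ ‖f x‖ * ‖f z‖ := real_inner_le_norm _ _
    have h3 : inner ℝ (f x) (f x) = (1 : ℝ) := by rw [real_inner_self_eq_norm_sq, h1]; norm_num
    have h4 := hle z hz
    rw [h1] at h2
    change inner ℝ (f x) (f z) ≤ inner ℝ (f x) (f x)
    linarith
  have hzero := hmax.hasFDerivAt_eq_zero ((innerSL ℝ (f x)).hasFDerivAt.comp x hf')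
  have hinj : Function.Injective (fderiv ℝ f x : E4 →ₗ[ℝ] E4) := fun u v huv => by
    have hu := DFunLike.congr_fun heq u
    have hv := DFunLike.congr_fun heq v
    simp only [ContinuousLinearMap.comp_apply, ContinuousLinearMap.id_apply] at hu hv
    have huv' : fderiv ℝ f x u = fderiv ℝ f x v := huv
    rw [← hu, ← hv, huv']
  obtain ⟨v, hv⟩ := (LinearMap.injective_iff_surjective.mp hinj) (f x)
  have hv' : fderiv ℝ f x v = f x := hv
  have h5 := DFunLike.congr_fun hzero v
  simp only [ContinuousLinearMap.comp_apply, hv', innerSL_apply_apply,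
    real_inner_self_eq_norm_sq, h1] at h5
  norm_num at h5

/-- A diffeomorphism of `B⁴` maps `S³` to itself. -/
theorem norm_eq_one_of_invOn {f g : E4 → E4} (hf : ContDiffOn ℝ ∞ f B4)
    (hg : ContDiffOn ℝ ∞ g B4) (hfm : MapsTo f B4 B4) (hgm : MapsTo g B4 B4)
    (hgf : LeftInvOn g f B4) (hfg : RightInvOn g f B4)
    {x : E4} (hx : ‖x‖ = 1) : ‖f x‖ = 1 := by
  have hxB : x ∈ B4 := by simpa using hx.le
  have h1 : ‖f x‖ ≤ 1 := by simpa using hfm hxB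
  refine h1.eq_of_not_lt fun h => ?_
  have h2 := norm_lt_one_of_leftInvOn hg hf hgm hfg h
  rw [hgf hxB, hx] at h2
  exact lt_irrefl _ h2

namespace BallIsotopy

variable (F : BallIsotopy)

theorem contDiffOn_toFun {t : ℝ} (ht : t ∈ Icc (0 : ℝ) 1) : ContDiffOn ℝ ∞ (F.toFun t) B4 :=
  F.smooth.comp (contDiff_const.prodMk contDiff_id).contDiffOn fun _ hx => ⟨ht, hx⟩

theorem contDiffOn_invFun {t : ℝ} (ht : t ∈ Icc (0 : ℝ) 1) : ContDiffOn ℝ ∞ (F.invFun t) B4 :=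
  F.smooth_inv.comp (contDiff_const.prodMk contDiff_id).contDiffOn fun _ hx => ⟨ht, hx⟩

/-- The bijection of `S³` that the diffeomorphism of `B⁴` at time `t` restricts to. -/
def boundaryMap (t : unitInterval) : Equiv.Perm S3 where
  toFun x := ⟨F.toFun t x, by
    simpa using norm_eq_one_of_invOn (F.contDiffOn_toFun t.2) (F.contDiffOn_invFun t.2)
      (F.mapsTo t t.2) (F.mapsTo_inv t t.2) (F.left_inv t t.2) (F.right_inv t t.2)
      (norm_eq_of_mem_sphere x)⟩
  invFun x := ⟨F.invFun t x, by
    simpa using norm_eq_one_of_invOn (F.contDiffOn_invFun t.2) (F.contDiffOn_toFun t.2)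
      (F.mapsTo_inv t t.2) (F.mapsTo t t.2) (F.right_inv t t.2) (F.left_inv t t.2)
      (norm_eq_of_mem_sphere x)⟩
  left_inv x := Subtype.ext (F.left_inv t t.2 (sphere_subset_closedBall x.2))
  right_inv x := Subtype.ext (F.right_inv t t.2 (sphere_subset_closedBall x.2))

/-- The ambient isotopy carries `S₀` to `S₁`. -/
def Carries (S₀ S₁ : Set E4) : Prop := F.toFun 1 '' S₀ = S₁

/-- The ambient isotopy is rel boundary: it fixes `S³` pointwise at all times. -/
def IsRelBoundary : Prop :=
  ∀ t ∈ Icc (0 : ℝ) 1, ∀ x : S3, F.toFun t x = x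

end BallIsotopy

/-- `S₀` and `S₁` are ambiently isotopic in `B⁴`. -/
def AmbientlyIsotopic (S₀ S₁ : Set E4) : Prop :=
  ∃ F : BallIsotopy, F.Carries S₀ S₁

/-- `S₀` and `S₁` are ambiently isotopic rel boundary in `B⁴`. -/
def AmbientlyIsotopicRelBoundary (S₀ S₁ : Set E4) : Prop :=
  ∃ F : BallIsotopy, F.IsRelBoundary ∧ F.Carries S₀ S₁

/-- The group `Diff(S³, K)` of the diffeomorphisms of `S³` that fix `K` setwise. -/
def DiffPair (K : Set S3) : Subgroup (Equiv.Perm S3) where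
  carrier := {φ | ContMDiff (𝓡 3) (𝓡 3) ∞ φ ∧ ContMDiff (𝓡 3) (𝓡 3) ∞ φ.symm ∧ φ '' K = K}
  mul_mem' := by
    rintro φ ψ ⟨h1, h2, h3⟩ ⟨k1, k2, k3⟩
    refine ⟨h1.comp k1, k2.comp h2, ?_⟩
    rw [Equiv.Perm.coe_mul, image_comp, k3, h3]
  one_mem' := ⟨contMDiff_id, contMDiff_id, image_id K⟩
  inv_mem' := by
    rintro φ ⟨h1, h2, h3⟩
    refine ⟨h2, h1, ?_⟩
    nth_rewrite 1 [← h3]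
    exact φ.symm_image_image K

/-- `φ` is isotopic to the identity through diffeomorphisms of the pair `(S³, K)`: there is a
smooth family, parametrized by `t ∈ [0,1]`, of diffeomorphisms of `S³` (with smooth family of
inverses) that fix `K` setwise, from `φ` at `t = 0` to the identity at `t = 1`. -/
def IsIsotopicToId (K : Set S3) (φ : Equiv.Perm S3) : Prop :=
  ∃ g : ℝ → Equiv.Perm S3,
    ContMDiffOn (𝓘(ℝ, ℝ).prod (𝓡 3)) (𝓡 3) ∞ (fun p : ℝ × S3 => g p.1 p.2)
      (Icc (0 : ℝ) 1 ×ˢ univ) ∧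
    ContMDiffOn (𝓘(ℝ, ℝ).prod (𝓡 3)) (𝓡 3) ∞ (fun p : ℝ × S3 => (g p.1).symm p.2)
      (Icc (0 : ℝ) 1 ×ˢ univ) ∧
    (∀ t ∈ Icc (0 : ℝ) 1, g t '' K = K) ∧ g 0 = φ ∧ g 1 = 1

/-- The subgroup of `Diff(S³, K)` of the diffeomorphisms that are isotopic to the identity through
diffeomorphisms of the pair. -/
def isotopicToIdSubgroup (K : Set S3) : Subgroup (DiffPair K) where
  carrier := {φ | IsIsotopicToId K φ}
  mul_mem' := by
    rintro φ ψ ⟨g, g1, g2, g3, g4, g5⟩ ⟨h, h1, h2, h3, h4, h5⟩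
    refine ⟨fun t => g t * h t, ?_, ?_, fun t ht => ?_, by simp [g4, h4], by simp [g5, h5]⟩
    · exact g1.comp (contMDiffOn_fst.prodMk h1) fun p hp => ⟨hp.1, mem_univ _⟩
    · exact h2.comp (contMDiffOn_fst.prodMk g2) fun p hp => ⟨hp.1, mem_univ _⟩
    · rw [Equiv.Perm.coe_mul, image_comp, h3 t ht, g3 t ht]
  one_mem' := ⟨fun _ => 1, contMDiffOn_snd, contMDiffOn_snd, fun _ _ => image_id K, rfl, rfl⟩
  inv_mem' := by
    rintro φ ⟨g, g1, g2, g3, g4, g5⟩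
    refine ⟨fun t => (g t)⁻¹, g2, g1, fun t ht => ?_, by simp [g4], by simp [g5]⟩
    nth_rewrite 1 [← g3 t ht]
    exact (g t).symm_image_image K

instance isotopicToIdSubgroup_normal (K : Set S3) : (isotopicToIdSubgroup K).Normal where
  conj_mem := by
    rintro φ ⟨g, g1, g2, g3, g4, g5⟩ ψ
    obtain ⟨h1, h2, h3⟩ := ψ.2
    refine ⟨fun t => (ψ : Equiv.Perm S3) * g t * (ψ : Equiv.Perm S3)⁻¹, ?_, ?_, fun t ht => ?_,
      by simp [g4], by simp [g5]⟩
    · exact h1.comp_contMDiffOn (g1.comp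
        (contMDiffOn_fst.prodMk (h2.comp_contMDiffOn contMDiffOn_snd))
        fun p hp => ⟨hp.1, mem_univ _⟩)
    · exact h1.comp_contMDiffOn (g2.comp
        (contMDiffOn_fst.prodMk (h2.comp_contMDiffOn contMDiffOn_snd))
        fun p hp => ⟨hp.1, mem_univ _⟩)
    · have h4 : ((ψ : Equiv.Perm S3)⁻¹ : Equiv.Perm S3) '' K = K :=
        ((DiffPair K).inv_mem ψ.2).2.2
      rw [Equiv.Perm.coe_mul, Equiv.Perm.coe_mul, image_comp, image_comp, h4, g3 t ht, h3]

/-- The symmetry group `Sym(K)`: the quotient of `Diff(S³, K)` by the normal subgroup of the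
diffeomorphisms that are isotopic to the identity through diffeomorphisms of the pair. -/
abbrev SymmetryGroup (K : Set S3) : Type := DiffPair K ⧸ isotopicToIdSubgroup K

end KnottedSurface

end

open KnottedSurface

noncomputable section

namespace KnottedSurface

open Filter Topology

/-! Only the final diffeomorphism `F.toFun 1` is used. It is corrected so that it fixes the sphere
pointwise and still carries `S₀` to `S₁`; the image of `S₀` is then compared with `S₀` rel boundary.
Correction: a diffeomorphism `D` rel boundary makes `S₁` equal, near the sphere, to the cone on `K`
(`exists_straightening`). The given isotopy of the pair, run in the radial direction, extends the
inverse of the boundary map to a diffeomorphism `G` of the ball, supported in that collar and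
preserving the cone (`IsIsotopicToId.exists_radial_extension`). Hence `G` preserves `D '' S₁`, and
`Φ = D⁻¹ ∘ G ∘ D ∘ F₁` carries `S₀` to `S₁` and is the identity on the sphere. Comparison: an
isotopy rel boundary makes `Φ` the identity near the sphere
(`IsBallDiffeo.exists_isotopy_to_id_near_sphere`). The resulting `f` need not be isotopic to the
identity rel boundary, but only the image of `S₀` matters. Conjugating `f` by shrinkings `J t` of
the ball into a small ball disjoint from `S₀` gives the isotopy `J t ∘ f ∘ (J t)⁻¹ ∘ f⁻¹`, which
starts at the identity and ends by carrying `f '' S₀` to `S₀`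
(`IsBallDiffeo.isotopic_image_of_eq_id_near_sphere`). The analytic tool behind the straightening and
the first isotopy is `lower_bound_of_slow_cutoff`. A displacement vanishing on the sphere is cut off
by a function of logarithmic type: the derivative of the cutoff is large only where the displacement
is proportionally small, so injectivity survives. -/

/-! ### Smooth inverses up to the boundary of the ball. -/

/-- The derivative of `g` is the inverse of the derivative of `f` taken at `g y`, so `n` derivatives
of `g` yield one more. Working with derivatives within the sets makes this bootstrap valid at
boundary points, where the inverse function theorem does not apply. -/
theorem contDiffOn_of_invOn {E : Type*} [NormedAddCommGroup E] [NormedSpace ℝ E]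
    [FiniteDimensional ℝ E] {f g : E → E} {s t : Set E} (hs : UniqueDiffOn ℝ s)
    (ht : UniqueDiffOn ℝ t) (hf : ContDiffOn ℝ ∞ f s) (hg : ContinuousOn g t)
    (hgm : MapsTo g t s) (hfg : RightInvOn g f t)
    (hinj : ∀ x ∈ s, Function.Injective (fderivWithin ℝ f s x)) : ContDiffOn ℝ ∞ g t := by
  have : CompleteSpace E := FiniteDimensional.complete ℝ E
  have hequiv : ∀ x ∈ s, ∃ e : E ≃L[ℝ] E, (e : E →L[ℝ] E) = fderivWithin ℝ f s x := fun x hx =>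
    ⟨(LinearEquiv.ofInjectiveEndo (fderivWithin ℝ f s x : E →ₗ[ℝ] E)
      (hinj x hx)).toContinuousLinearEquiv, by ext v; rfl⟩
  have hder : ∀ y ∈ t, HasFDerivWithinAt g
      (ContinuousLinearMap.inverse (fderivWithin ℝ f s (g y))) t y := by
    intro y hy
    obtain ⟨e, he⟩ := hequiv (g y) (hgm hy)
    have h1 : HasFDerivWithinAt f (e : E →L[ℝ] E) s (g y) := by
      rw [he]
      exact (hf.differentiableOn (by simp) _ (hgm hy)).hasFDerivWithinAt
    rw [← he, ContinuousLinearMap.inverse_equiv]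
    refine HasFDerivWithinAt.of_local_left_inverse (f := f) (t := s) ?_ h1 hy ?_
    · exact tendsto_nhdsWithin_iff.2 ⟨hg y hy, eventually_mem_nhdsWithin.mono fun z hz => hgm hz⟩
    · exact eventually_mem_nhdsWithin.mono fun z hz => hfg hz
  refine contDiffOn_infty.2 fun n => ?_
  induction n with
  | zero => exact contDiffOn_zero.2 hg
  | succ n ih =>
    rw [Nat.cast_add, Nat.cast_one, contDiffOn_succ_iff_hasFDerivWithinAt_of_uniqueDiffOn ht]
    refine ⟨by simp, fun y => ContinuousLinearMap.inverse (fderivWithin ℝ f s (g y)), ?_, hder⟩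
    have h2 : ContDiffOn ℝ n (fderivWithin ℝ f s) s := hf.fderivWithin hs (by exact_mod_cast le_top)
    intro y hy
    obtain ⟨e, he⟩ := hequiv (g y) (hgm hy)
    have h3 : ContDiffAt ℝ n (ContinuousLinearMap.inverse (R := ℝ) (M := E) (M₂ := E))
        (fderivWithin ℝ f s (g y)) := he ▸ contDiffAt_map_inverse e
    exact h3.comp_contDiffWithinAt y ((h2.comp ih hgm) y hy)

theorem uniqueDiffOn_B4 : UniqueDiffOn ℝ B4 := by
  refine uniqueDiffOn_convex (convex_closedBall _ _) ?_
  rw [interior_closedBall _ one_ne_zero]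
  exact ⟨0, by simp⟩

theorem uniqueDiffOn_Icc_prod_B4 : UniqueDiffOn ℝ (Icc (0 : ℝ) 1 ×ˢ B4) :=
  (uniqueDiffOn_Icc_zero_one).prod uniqueDiffOn_B4

theorem eventually_add_smul_mem_B4 {x v : E4} (hx : ‖x‖ ≤ 1) (hv : inner ℝ x v < 0) :
    ∀ᶠ t : ℝ in 𝓝[>] 0, x + t • v ∈ B4 := by
  have h1 : ∀ᶠ t : ℝ in 𝓝 0, 2 * inner ℝ x v + t * ‖v‖ ^ 2 < 0 := by
    refine ContinuousAt.eventually_lt (by fun_prop) (by fun_prop) ?_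
    linarith
  filter_upwards [h1.filter_mono nhdsWithin_le_nhds, self_mem_nhdsWithin] with t ht ht0
  have ht0' : 0 < t := ht0
  rw [mem_closedBall_zero_iff, ← sq_le_one_iff₀ (norm_nonneg _), norm_add_sq_real, inner_smul_right,
    norm_smul, Real.norm_of_nonneg ht0'.le]
  nlinarith [norm_nonneg x]

/-- Difference quotients along segments that stay in the ball give the bound. At a point of the
sphere this covers inward directions; outward ones follow by a change of sign and tangential ones by
a limit. -/
theorem le_norm_apply_of_lower_bound {f : E4 → E4} {f' : E4 →L[ℝ] E4} {x : E4} {c : ℝ}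
    (hx : x ∈ B4) (hf : HasFDerivWithinAt f f' B4 x)
    (hc : ∀ y ∈ B4, c * ‖y - x‖ ≤ ‖f y - f x‖) (v : E4) : c * ‖v‖ ≤ ‖f' v‖ := by
  have key : ∀ v : E4, (∀ᶠ t : ℝ in 𝓝[>] 0, x + t • v ∈ B4) → c * ‖v‖ ≤ ‖f' v‖ := by
    intro v hv
    have hline : HasDerivWithinAt (fun t : ℝ => x + t • v) v {t | x + t • v ∈ B4} 0 := by
      simpa using (((hasDerivAt_id (0 : ℝ)).smul_const v).const_add x).hasDerivWithinAt
    have h1 : HasDerivWithinAt (fun t : ℝ => f (x + t • v)) (f' v) {t | x + t • v ∈ B4} 0 := by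
      refine HasFDerivWithinAt.comp_hasDerivWithinAt (t := B4) (0 : ℝ) ?_ hline (fun t ht => ht)
      simpa using hf
    have h2 : HasDerivWithinAt (fun t : ℝ => f (x + t • v)) (f' v) (Ioi 0) 0 :=
      h1.mono_of_mem_nhdsWithin hv
    have h3 := (hasDerivWithinAt_iff_tendsto_slope' (by simp)).1 h2
    refine ge_of_tendsto h3.norm ?_
    filter_upwards [hv, self_mem_nhdsWithin] with t ht ht0
    have ht0' : 0 < t := ht0
    have h4 := hc _ ht
    rw [add_sub_cancel_left, norm_smul, Real.norm_of_nonneg ht0'.le] at h4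
    rw [slope_def_module, norm_smul]
    simp only [sub_zero, zero_smul, add_zero, norm_inv, Real.norm_of_nonneg ht0'.le]
    rw [inv_mul_eq_div, le_div_iff₀ ht0']
    linarith
  have hx1 : ‖x‖ ≤ 1 := by simpa using hx
  rcases hx1.lt_or_eq with hlt | heq
  · refine key v (Eventually.filter_mono nhdsWithin_le_nhds ?_)
    have hcont : ContinuousAt (fun t : ℝ => ‖x + t • v‖) 0 := by fun_prop
    have := hcont.eventually_lt (continuousAt_const (y := (1 : ℝ))) (by simpa using hlt)
    exact this.mono fun t ht => by simpa using ht.le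
  · have hne : ∀ v : E4, inner ℝ x v ≠ 0 → c * ‖v‖ ≤ ‖f' v‖ := by
      intro v hv
      rcases hv.lt_or_gt with h | h
      · exact key v (eventually_add_smul_mem_B4 hx1 h)
      · have := key (-v) (eventually_add_smul_mem_B4 hx1 (by simpa using h))
        simpa using this
    by_cases hv : inner ℝ x v = 0
    -- A tangential `v` is the limit of the non-tangential vectors `v + t • x`.
    · have hcont : Tendsto (fun t : ℝ => ‖f' (v + t • x)‖ - c * ‖v + t • x‖) (𝓝[≠] 0)
          (𝓝 (‖f' v‖ - c * ‖v‖)) := by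
        have : ContinuousAt (fun t : ℝ => ‖f' (v + t • x)‖ - c * ‖v + t • x‖) 0 := by fun_prop
        simpa using this.tendsto.mono_left (nhdsWithin_le_nhds (s := {0}ᶜ))
      have := ge_of_tendsto hcont (b := 0) (by
        filter_upwards [self_mem_nhdsWithin] with t ht
        refine sub_nonneg.2 (hne _ ?_)
        rw [inner_add_right, hv, inner_smul_right, real_inner_self_eq_norm_sq, heq]
        simpa using ht)
      linarith
    · exact hne v hv

/-- The uniform lower bound supplies injectivity, invertible derivatives and a Lipschitz bound for
the inverses that is independent of `t`; surjectivity is a connectedness argument. -/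
theorem exists_smooth_inverse_family {Ψ : ℝ → E4 → E4}
    (hsm : ContDiffOn ℝ ∞ (fun p : ℝ × E4 => Ψ p.1 p.2) (Icc (0 : ℝ) 1 ×ˢ B4))
    (hS : ∀ t ∈ Icc (0 : ℝ) 1, ∀ x, ‖x‖ = 1 → Ψ t x = x)
    (hlt : ∀ t ∈ Icc (0 : ℝ) 1, ∀ x, ‖x‖ < 1 → ‖Ψ t x‖ < 1) {c : ℝ} (hc : 0 < c)
    (hlow : ∀ t ∈ Icc (0 : ℝ) 1, ∀ x ∈ B4, ∀ y ∈ B4, c * ‖x - y‖ ≤ ‖Ψ t x - Ψ t y‖) :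
    ∃ Ψ' : ℝ → E4 → E4, (∀ t ∈ Icc (0 : ℝ) 1, MapsTo (Ψ t) B4 B4) ∧
      (∀ t ∈ Icc (0 : ℝ) 1, MapsTo (Ψ' t) B4 B4) ∧
      (∀ t ∈ Icc (0 : ℝ) 1, LeftInvOn (Ψ' t) (Ψ t) B4) ∧
      (∀ t ∈ Icc (0 : ℝ) 1, RightInvOn (Ψ' t) (Ψ t) B4) ∧
      ContDiffOn ℝ ∞ (fun p : ℝ × E4 => Ψ' p.1 p.2) (Icc (0 : ℝ) 1 ×ˢ B4) := by
  have hmaps : ∀ t ∈ Icc (0 : ℝ) 1, MapsTo (Ψ t) B4 B4 := by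
    intro t ht x hx
    have hx1 : ‖x‖ ≤ 1 := by simpa using hx
    rcases hx1.lt_or_eq with h | h
    · simpa using (hlt t ht x h).le
    · rw [hS t ht x h]; exact hx
  have hΨt : ∀ t ∈ Icc (0 : ℝ) 1, ContDiffOn ℝ ∞ (Ψ t) B4 := fun t ht =>
    hsm.comp (contDiff_const.prodMk contDiff_id).contDiffOn fun _ hx => ⟨ht, hx⟩
  have hinj : ∀ t ∈ Icc (0 : ℝ) 1, InjOn (Ψ t) B4 := by
    intro t ht x hx y hy hxy
    have := hlow t ht x hx y hy
    rw [hxy, sub_self, norm_zero] at this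
    have h0 : ‖x - y‖ ≤ 0 := by nlinarith [norm_nonneg (x - y)]
    exact sub_eq_zero.1 (norm_le_zero_iff.1 h0)
  have hballB : ball (0 : E4) 1 ⊆ B4 := ball_subset_closedBall
  have hsurj : ∀ t ∈ Icc (0 : ℝ) 1, SurjOn (Ψ t) B4 B4 := by
    intro t ht
    have hopen : IsOpen (Ψ t '' ball 0 1) := by
      rw [isOpen_iff_mem_nhds]
      rintro _ ⟨x, hx, rfl⟩
      have hN : ball (0 : E4) 1 ∈ 𝓝 x := isOpen_ball.mem_nhds hx
      have hat : ContDiffAt ℝ ∞ (Ψ t) x := (hΨt t ht).contDiffAt (mem_of_superset hN hballB)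
      have hst : HasStrictFDerivAt (Ψ t) (fderiv ℝ (Ψ t) x) x := hat.hasStrictFDerivAt (by simp)
      have hi : Function.Injective (fderiv ℝ (Ψ t) x : E4 →ₗ[ℝ] E4) := by
        rw [← LinearMap.ker_eq_bot, LinearMap.ker_eq_bot']
        intro v hv
        have h1 := le_norm_apply_of_lower_bound (hballB hx) hst.hasFDerivAt.hasFDerivWithinAt
          (fun y hy => hlow t ht y hy x (hballB hx)) v
        have hv' : fderiv ℝ (Ψ t) x v = 0 := hv
        rw [hv', norm_zero] at h1
        exact norm_le_zero_iff.1 (by nlinarith [norm_nonneg v])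
      have hsu := LinearMap.injective_iff_surjective.1 hi
      rw [← hst.map_nhds_eq_of_surj (LinearMap.range_eq_top.2 hsu)]
      exact image_mem_map hN
    have hcomp : IsClosed (Ψ t '' B4) :=
      ((isCompact_closedBall _ _).image_of_continuousOn (hΨt t ht).continuousOn).isClosed
    have hsub : ball (0 : E4) 1 ⊆ Ψ t '' ball 0 1 := by
      -- The image of the open ball is open, and relatively closed in the open ball because points
      -- of the sphere are fixed and so contribute no interior values.
      refine (convex_ball (0 : E4) 1).isPreconnected.subset_of_closure_inter_subset hopen
        ⟨Ψ t 0, by simpa using hlt t ht 0 (by simp), mem_image_of_mem _ (by simp)⟩ ?_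
      rintro y ⟨hy, hyb⟩
      obtain ⟨x, hx, rfl⟩ := closure_minimal (image_mono hballB) hcomp hy
      have hx1 : ‖x‖ ≤ 1 := by simpa using hx
      rcases hx1.lt_or_eq with h | h
      · exact mem_image_of_mem _ (by simpa using h)
      · rw [hS t ht x h] at hyb
        simp [h] at hyb
    intro y hy
    have hy1 : ‖y‖ ≤ 1 := by simpa using hy
    rcases hy1.lt_or_eq with h | h
    · exact image_mono hballB (hsub (by simpa using h))
    · exact ⟨y, hy, hS t ht y h⟩
  set Ψ' : ℝ → E4 → E4 := fun t => Function.invFunOn (Ψ t) B4 with hΨ'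
  have hm' : ∀ t ∈ Icc (0 : ℝ) 1, MapsTo (Ψ' t) B4 B4 := fun t ht y hy =>
    Function.invFunOn_mem (hsurj t ht hy)
  have hr : ∀ t ∈ Icc (0 : ℝ) 1, RightInvOn (Ψ' t) (Ψ t) B4 := fun t ht y hy =>
    Function.invFunOn_eq (hsurj t ht hy)
  have hl : ∀ t ∈ Icc (0 : ℝ) 1, LeftInvOn (Ψ' t) (Ψ t) B4 := fun t ht x hx =>
    hinj t ht (hm' t ht (hmaps t ht hx)) hx (hr t ht (hmaps t ht hx))
  refine ⟨Ψ', hmaps, hm', hl, hr, ?_⟩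
  have hcont : ContinuousOn (fun p : ℝ × E4 => Ψ' p.1 p.2) (Icc (0 : ℝ) 1 ×ˢ B4) := by
    rintro ⟨t, y⟩ ⟨ht, hy⟩
    set a := Ψ' t y with ha
    have hab : a ∈ B4 := hm' t ht hy
    -- Joint continuity at `(t, y)`: the lower bound controls the distance from `Ψ' s z` to `a` by
    -- that from `z` to `Ψ s a`, which tends to zero.
    have h1 : ContinuousWithinAt (fun p : ℝ × E4 => c⁻¹ * ‖p.2 - Ψ p.1 a‖)
        (Icc (0 : ℝ) 1 ×ˢ B4) (t, y) := by
      have h2 : ContinuousOn (fun p : ℝ × E4 => Ψ p.1 a) (Icc (0 : ℝ) 1 ×ˢ B4) :=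
        hsm.continuousOn.comp (continuousOn_fst.prodMk continuousOn_const) fun p hp => ⟨hp.1, hab⟩
      exact continuousWithinAt_const.mul
        ((continuousWithinAt_snd.sub (h2 _ ⟨ht, hy⟩)).norm)
    have h3 : Tendsto (fun p : ℝ × E4 => c⁻¹ * ‖p.2 - Ψ p.1 a‖)
        (𝓝[Icc (0 : ℝ) 1 ×ˢ B4] (t, y)) (𝓝 0) := by
      have := h1.tendsto
      simpa [ha, hr t ht hy] using this
    refine tendsto_iff_norm_sub_tendsto_zero.2
      (squeeze_zero' (Eventually.of_forall fun _ => norm_nonneg _) ?_ h3)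
    filter_upwards [self_mem_nhdsWithin] with p hp
    have h4 := hlow p.1 hp.1 (Ψ' p.1 p.2) (hm' _ hp.1 hp.2) a hab
    rw [hr p.1 hp.1 hp.2] at h4
    rw [inv_mul_eq_div, le_div_iff₀ hc]
    simpa [mul_comm] using h4
  have hP : ContDiffOn ℝ ∞ (fun p : ℝ × E4 => (p.1, Ψ' p.1 p.2)) (Icc (0 : ℝ) 1 ×ˢ B4) := by
    -- Smoothness jointly in time and space comes from inverting the level-preserving map of the
    -- product.
    refine contDiffOn_of_invOn (f := fun p : ℝ × E4 => (p.1, Ψ p.1 p.2))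
      uniqueDiffOn_Icc_prod_B4 uniqueDiffOn_Icc_prod_B4 (contDiff_fst.contDiffOn.prodMk hsm)
      (continuousOn_fst.prodMk hcont) (fun p hp => ⟨hp.1, hm' _ hp.1 hp.2⟩)
      (fun p hp => Prod.ext rfl (hr p.1 hp.1 hp.2)) ?_
    rintro ⟨t, x⟩ ⟨ht, hx⟩
    have hd := (hsm.differentiableOn (by simp) (t, x) ⟨ht, hx⟩).hasFDerivWithinAt
    set A := fderivWithin ℝ (fun p : ℝ × E4 => Ψ p.1 p.2) (Icc (0 : ℝ) 1 ×ˢ B4) (t, x)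
    have hd2 : HasFDerivWithinAt (fun p : ℝ × E4 => (p.1, Ψ p.1 p.2))
        ((ContinuousLinearMap.fst ℝ ℝ E4).prod A) (Icc (0 : ℝ) 1 ×ˢ B4) (t, x) :=
      hasFDerivWithinAt_fst.prodMk hd
    rw [hd2.fderivWithin (uniqueDiffOn_Icc_prod_B4 _ ⟨ht, hx⟩)]
    have hd3 : HasFDerivWithinAt (Ψ t) (A ∘L ContinuousLinearMap.inr ℝ ℝ E4) B4 x :=
      hd.comp x (hasFDerivAt_prodMk_right t x).hasFDerivWithinAt fun z hz => ⟨ht, hz⟩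
    rw [injective_iff_map_eq_zero]
    rintro ⟨τ, v⟩ h
    obtain ⟨h5, h6⟩ := Prod.ext_iff.1 h
    have hτ : τ = 0 := h5
    subst hτ
    have h7 := le_norm_apply_of_lower_bound hx hd3 (fun y hy => hlow t ht y hy x hx) v
    have h8 : (A ∘L ContinuousLinearMap.inr ℝ ℝ E4) v = 0 := h6
    rw [h8, norm_zero] at h7
    have : v = 0 := norm_le_zero_iff.1 (by nlinarith [norm_nonneg v])
    rw [this]; rfl
  exact contDiff_snd.comp_contDiffOn hP

/-! ### Slow cutoffs of displacements that vanish on the sphere. -/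

theorem exists_lipschitzWith_smoothTransition :
    ∃ C : ℝ, 0 < C ∧ ∀ a b, |Real.smoothTransition b - Real.smoothTransition a| ≤ C * |b - a| := by
  have h1 : ContDiff ℝ 1 Real.smoothTransition := Real.smoothTransition.contDiff (n := 1)
  obtain ⟨C, hC⟩ := isCompact_Icc.exists_bound_of_continuousOn (s := Icc (0 : ℝ) 1)
    (h1.continuous_deriv le_rfl).continuousOn
  refine ⟨max C 1, by positivity, fun a b => ?_⟩
  have hb : ∀ x ∈ (univ : Set ℝ), ‖deriv Real.smoothTransition x‖ ≤ max C 1 := by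
    intro x _
    by_cases hx : x ∈ Icc (0 : ℝ) 1
    · exact (hC x hx).trans (le_max_left _ _)
    · have : deriv Real.smoothTransition x = 0 := by
        rw [mem_Icc, not_and_or, not_le, not_le] at hx
        rcases hx with hx | hx
        · have : Real.smoothTransition =ᶠ[𝓝 x] fun _ => 0 :=
            (eventually_lt_nhds hx).mono fun z hz => Real.smoothTransition.zero_of_nonpos hz.le
          rw [this.deriv_eq, deriv_const]
        · have : Real.smoothTransition =ᶠ[𝓝 x] fun _ => 1 :=
            (eventually_gt_nhds hx).mono fun z hz => Real.smoothTransition.one_of_one_le hz.le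
          rw [this.deriv_eq, deriv_const]
      rw [this, norm_zero]
      positivity
  simpa [Real.norm_eq_abs] using convex_univ.norm_image_sub_le_of_norm_deriv_le
    (fun x _ => h1.differentiable one_ne_zero x) hb (mem_univ a) (mem_univ b)

/-- A smooth step function on `[0, ∞)` whose logarithmic derivative is arbitrarily small. -/
theorem exists_slow_cutoff {η κ : ℝ} (hη : 0 < η) (hκ : 0 < κ) :
    ∃ l : ℝ → ℝ, ∃ δ > 0, ContDiff ℝ ∞ l ∧ (∀ u, l u ∈ Icc (0 : ℝ) 1) ∧ (∀ u < δ, l u = 0) ∧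
      (∀ u, η ≤ u → l u = 1) ∧ ∀ a b, 0 < a → a ≤ b → |l b - l a| * a ≤ κ * (b - a) := by
  obtain ⟨C, hC, hL⟩ := exists_lipschitzWith_smoothTransition
  set k := κ / C with hk
  have hk0 : 0 < k := by positivity
  -- A step in the variable `log u` has `u * l' u` bounded by `C * k = κ`; the price is a very small
  -- `δ`.
  set l : ℝ → ℝ := fun u => if u ≤ 0 then 0 else Real.smoothTransition (1 + k * Real.log (u / η))
    with hl
  -- The point at which `1 + k * log (u / η)` vanishes.
  set δ := η * Real.exp (-(1 / k)) with hδ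
  have hδ0 : 0 < δ := by positivity
  have hpos : ∀ u, 0 < u → l u = Real.smoothTransition (1 + k * Real.log (u / η)) := fun u hu => by
    simp only [hl, if_neg hu.not_ge]
  have hzero : ∀ u < δ, l u = 0 := by
    intro u hu
    by_cases hu0 : u ≤ 0
    · simp [hl, hu0]
    · push Not at hu0
      rw [hpos u hu0]
      refine Real.smoothTransition.zero_of_nonpos ?_
      have h1 : Real.log (u / η) ≤ -(1 / k) := by
        rw [Real.log_le_iff_le_exp (by positivity), div_le_iff₀ hη]
        linarith
      have h2 := mul_le_mul_of_nonneg_left h1 hk0.le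
      have h3 : k * -(1 / k) = -1 := by field_simp
      linarith
  refine ⟨l, δ, hδ0, ?_, fun u => ?_, hzero, fun u hu => ?_, fun a b ha hab => ?_⟩
  · rw [contDiff_iff_contDiffAt]
    intro u
    by_cases hu : u < δ
    · exact (contDiffAt_const (c := (0 : ℝ))).congr_of_eventuallyEq
        ((eventually_lt_nhds hu).mono fun z hz => hzero z hz)
    · have hu0 : 0 < u := hδ0.trans_le (not_lt.1 hu)
      refine ContDiffAt.congr_of_eventuallyEq ?_
        ((eventually_gt_nhds hu0).mono fun z hz => hpos z hz)
      refine Real.smoothTransition.contDiffAt.comp u ?_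
      refine contDiffAt_const.add (contDiffAt_const.mul ?_)
      exact ContDiffAt.log (contDiffAt_id.div_const _) (by simp [hu0.ne', hη.ne'])
  · by_cases hu : u ≤ 0
    · simp [hl, hu]
    · rw [hpos u (not_le.1 hu)]
      exact ⟨Real.smoothTransition.nonneg _, Real.smoothTransition.le_one _⟩
  · rw [hpos u (hη.trans_le hu)]
    refine Real.smoothTransition.one_of_one_le ?_
    have : 0 ≤ Real.log (u / η) := Real.log_nonneg (by rwa [le_div_iff₀ hη, one_mul])
    nlinarith
  · have hb := ha.trans_le hab
    rw [hpos a ha, hpos b hb]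
    refine (mul_le_mul_of_nonneg_right (hL _ _) ha.le).trans ?_
    have h1 : 1 + k * Real.log (b / η) - (1 + k * Real.log (a / η)) = k * Real.log (b / a) := by
      rw [Real.log_div hb.ne' hη.ne', Real.log_div ha.ne' hη.ne', Real.log_div hb.ne' ha.ne']
      ring
    have h2 : 0 ≤ Real.log (b / a) := Real.log_nonneg (by rwa [le_div_iff₀ ha, one_mul])
    have h3 : Real.log (b / a) ≤ b / a - 1 := Real.log_le_sub_one_of_pos (by positivity)
    rw [h1, abs_of_nonneg (by positivity)]
    have h4 : C * (k * Real.log (b / a)) * a = κ * (Real.log (b / a) * a) := by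
      rw [hk]; field_simp
    have h5 : Real.log (b / a) * a ≤ b - a := by
      have := mul_le_mul_of_nonneg_right h3 ha.le
      rwa [sub_mul, div_mul_cancel₀ _ ha.ne', one_mul] at this
    rw [h4]
    exact mul_le_mul_of_nonneg_left h5 hκ.le

theorem exists_lipschitz_on_B4 {e : E4 → E4} (he : ContDiffOn ℝ ∞ e B4) :
    ∃ L : ℝ, 0 < L ∧ (∀ x ∈ B4, ‖fderivWithin ℝ e B4 x‖ ≤ L) ∧
      ∀ x ∈ B4, ∀ y ∈ B4, ‖e x - e y‖ ≤ L * ‖x - y‖ := by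
  obtain ⟨C, hC⟩ := (isCompact_closedBall (0 : E4) 1).exists_bound_of_continuousOn
    (he.continuousOn_fderivWithin uniqueDiffOn_B4 (by simp))
  have hC' : ∀ x ∈ B4, ‖fderivWithin ℝ e B4 x‖ ≤ max C 1 := fun x hx =>
    (hC x hx).trans (le_max_left _ _)
  exact ⟨max C 1, by positivity, hC', fun x hx y hy =>
    (convex_closedBall (0 : E4) 1).norm_image_sub_le_of_norm_fderivWithin_le
      (he.differentiableOn (by simp)) hC' hy hx⟩

/-- The function `1 - ‖x‖ ^ 2` replaces the distance `1 - ‖x‖` to the sphere throughout: it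
dominates it on the ball and is smooth at the origin as well. -/
theorem exists_unit_vector_near {x : E4} (hx : ‖x‖ ≤ 1) :
    ∃ p : E4, ‖p‖ = 1 ∧ ‖x - p‖ ≤ 1 - ‖x‖ ^ 2 := by
  have hle : 1 - ‖x‖ ≤ 1 - ‖x‖ ^ 2 := by nlinarith [norm_nonneg x]
  by_cases h0 : x = 0
  · obtain ⟨p, hp⟩ := exists_norm_eq E4 zero_le_one
    exact ⟨p, hp, by simp [h0, hp]⟩
  · have hn : 0 < ‖x‖ := norm_pos_iff.2 h0
    refine ⟨‖x‖⁻¹ • x, by rw [norm_smul, norm_inv, norm_norm, inv_mul_cancel₀ hn.ne'], ?_⟩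
    have h1 : x - ‖x‖⁻¹ • x = (1 - ‖x‖⁻¹) • x := by rw [sub_smul, one_smul]
    have h2 : 1 ≤ ‖x‖⁻¹ := (one_le_inv₀ hn).2 hx
    rw [h1, norm_smul, Real.norm_of_nonpos (by linarith)]
    have h3 : -(1 - ‖x‖⁻¹) * ‖x‖ = 1 - ‖x‖ := by field_simp; ring
    linarith

/-- A map that vanishes on the sphere has derivative zero in the tangential directions. -/
theorem fderivWithin_apply_of_inner_eq_zero {e : E4 → E4} (he : ContDiffOn ℝ ∞ e B4)
    (he0 : ∀ x, ‖x‖ = 1 → e x = 0) {p w : E4} (hp : ‖p‖ = 1) (hw : inner ℝ p w = 0) :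
    fderivWithin ℝ e B4 p w = 0 := by
  by_cases hw0 : w = 0
  · rw [hw0, map_zero]
  have hn : 0 < ‖w‖ := norm_pos_iff.2 hw0
  set v := ‖w‖⁻¹ • w with hv
  have hv1 : ‖v‖ = 1 := by rw [hv, norm_smul, norm_inv, norm_norm, inv_mul_cancel₀ hn.ne']
  have hpv : inner ℝ p v = 0 := by rw [hv, inner_smul_right, hw, mul_zero]
  -- The great circle through `p` with velocity `v`, along which `e` vanishes.
  set c : ℝ → E4 := fun t => Real.cos t • p + Real.sin t • v with hc
  have hcn : ∀ t, ‖c t‖ = 1 := by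
    intro t
    rw [← sq_eq_sq₀ (norm_nonneg _) zero_le_one, hc]
    simp only
    rw [norm_add_sq_real, norm_smul, norm_smul, hp, hv1, inner_smul_left, inner_smul_right, hpv]
    simp [sq_abs]
  have hcd : HasDerivAt c v 0 := by
    have := ((Real.hasDerivAt_cos 0).smul_const p).add ((Real.hasDerivAt_sin 0).smul_const v)
    exact this.congr_deriv (by simp)
  have hpB : p ∈ B4 := by simp [hp]
  have h1 : HasFDerivWithinAt e (fderivWithin ℝ e B4 p) B4 (c 0) := by
    simpa [hc] using (he.differentiableOn (by simp) p hpB).hasFDerivWithinAt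
  have h2 : HasDerivWithinAt (fun t => e (c t)) (fderivWithin ℝ e B4 p v) univ 0 :=
    h1.comp_hasDerivWithinAt (t := B4) (0 : ℝ) hcd.hasDerivWithinAt fun t _ => by simp [hcn]
  rw [hasDerivWithinAt_univ] at h2
  have h3 : (fun t => e (c t)) = fun _ => 0 := funext fun t => he0 _ (hcn t)
  rw [h3] at h2
  have h4 := h2.unique (hasDerivAt_const (0 : ℝ) (0 : E4))
  rw [hv, map_smul] at h4
  exact (smul_eq_zero.1 h4).resolve_left (inv_ne_zero hn.ne')

/-- Multiplying a displacement `e` that vanishes on the sphere by a function which varies slowly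
near the sphere results in a displacement that is still injective. -/
theorem lower_bound_of_slow_cutoff {e : E4 → E4} (he : ContDiffOn ℝ ∞ e B4)
    (he0 : ∀ x, ‖x‖ = 1 → e x = 0) {m₀ : ℝ} {c₀ : ℝ} (hc₀ : 0 < c₀)
    (hdeep : ∀ x ∈ B4, ∀ y ∈ B4, c₀ * ‖x - y‖ ≤ ‖(x - y) + m₀ • (e x - e y)‖) {a₀ : ℝ}
    (ha₀ : 0 < a₀) (hb : ∀ p, ‖p‖ = 1 → a₀ ≤ 1 + inner ℝ p (fderivWithin ℝ e B4 p p)) :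
    ∃ η > 0, ∃ κ > 0, ∃ c > 0, ∀ m : E4 → ℝ, (∀ x ∈ B4, m x ∈ Icc (0 : ℝ) 1) →
      (∀ x ∈ B4, η ≤ 1 - ‖x‖ ^ 2 → m x = m₀) →
      (∀ x ∈ B4, ∀ y ∈ B4, 0 < 1 - ‖y‖ ^ 2 → ‖x‖ ≤ ‖y‖ →
        |m x - m y| * (1 - ‖y‖ ^ 2) ≤ κ * (‖y‖ ^ 2 - ‖x‖ ^ 2)) →
      ∀ x ∈ B4, ∀ y ∈ B4, c * ‖x - y‖ ≤ ‖(x + m x • e x) - (y + m y • e y)‖ := by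
  obtain ⟨L, hL, hDL, hLip⟩ := exists_lipschitz_on_B4 he
  set a₁ := min 1 a₀ with ha₁
  have ha₁0 : 0 < a₁ := lt_min one_pos ha₀
  set c₁ := 1 / (1 + L / a₁) with hc₁
  have hc₁0 : 0 < c₁ := by positivity
  set c₂ := min (min c₀ c₁) 1 with hc₂
  have hc₂0 : 0 < c₂ := lt_min (lt_min hc₀ hc₁0) one_pos
  have hc₂₀ : c₂ ≤ c₀ := (min_le_left _ _).trans (min_le_left _ _)
  have hc₂₁ : c₂ ≤ c₁ := (min_le_left _ _).trans (min_le_right _ _)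
  have hc₂₂ : c₂ ≤ 1 := min_le_right _ _
  have hunif := (isCompact_closedBall (0 : E4) 1).uniformContinuousOn_of_continuous
    (he.continuousOn_fderivWithin uniqueDiffOn_B4 (by simp))
  obtain ⟨ζ, hζ, hunif⟩ := Metric.uniformContinuousOn_iff.1 hunif (c₂ / 4) (by positivity)
  have heu : ∀ y ∈ B4, ‖e y‖ ≤ L * (1 - ‖y‖ ^ 2) := by
    intro y hy
    obtain ⟨p, hp, hyp⟩ := exists_unit_vector_near (x := y) (by simpa using hy)
    have := hLip y hy p (by simp [hp])
    rw [he0 p hp, sub_zero] at this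
    exact this.trans (mul_le_mul_of_nonneg_left hyp hL.le)
  -- On the sphere the derivative of `e` kills tangent vectors, so it is `w ↦ ⟪p, w⟫ b`. Then `id +
  -- m De` multiplies the normal component by `1 + m ⟪p, b⟫ ≥ min 1 a₀`, which makes it invertible
  -- uniformly in `m` and `p`.
  have hT : ∀ p w : E4, ‖p‖ = 1 → ∀ m ∈ Icc (0 : ℝ) 1,
      c₁ * ‖w‖ ≤ ‖w + m • fderivWithin ℝ e B4 p w‖ := by
    intro p w hp m hm
    set b := fderivWithin ℝ e B4 p p with hbdef
    have hpB : p ∈ B4 := by simp [hp]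
    have hD : fderivWithin ℝ e B4 p w = (inner ℝ p w) • b := by
      have h1 := fderivWithin_apply_of_inner_eq_zero he he0 hp (w := w - (inner ℝ p w) • p) (by
        rw [inner_sub_right, inner_smul_right, real_inner_self_eq_norm_sq, hp]; ring)
      rw [map_sub, map_smul, sub_eq_zero] at h1
      exact h1
    have hbn : ‖b‖ ≤ L := by
      have := (fderivWithin ℝ e B4 p).le_opNorm p
      rw [hp, mul_one] at this
      exact this.trans (hDL p hpB)
    set V := w + m • fderivWithin ℝ e B4 p w with hV
    have h2 : inner ℝ p V = inner ℝ p w * (1 + m * inner ℝ p b) := by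
      rw [hV, hD, inner_add_right, inner_smul_right, inner_smul_right]; ring
    have h3 : a₁ ≤ 1 + m * inner ℝ p b := by
      have h4 := hb p hp
      have h5 : a₁ ≤ 1 := min_le_left _ _
      have h6 : a₁ ≤ a₀ := min_le_right _ _
      nlinarith [hm.1, hm.2]
    have h4 : |inner ℝ p w| * a₁ ≤ ‖V‖ := by
      have h5 : |inner ℝ p V| ≤ ‖V‖ := by simpa [hp] using abs_real_inner_le_norm p V
      rw [h2, abs_mul, abs_of_pos (ha₁0.trans_le h3)] at h5
      exact (mul_le_mul_of_nonneg_left h3 (abs_nonneg _)).trans h5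
    have h5 : ‖w‖ ≤ ‖V‖ + |inner ℝ p w| * L := by
      have h6 : w = V - m • fderivWithin ℝ e B4 p w := by rw [hV]; abel
      calc ‖w‖ = ‖V - m • fderivWithin ℝ e B4 p w‖ := by rw [← h6]
        _ ≤ ‖V‖ + ‖m • fderivWithin ℝ e B4 p w‖ := norm_sub_le _ _
        _ ≤ ‖V‖ + |inner ℝ p w| * L := by
          rw [hD, norm_smul, norm_smul, Real.norm_eq_abs, Real.norm_eq_abs, abs_of_nonneg hm.1]
          have h7 : |inner ℝ p w| * ‖b‖ ≤ |inner ℝ p w| * L :=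
            mul_le_mul_of_nonneg_left hbn (abs_nonneg _)
          have h8 : 0 ≤ |inner ℝ p w| * ‖b‖ := by positivity
          nlinarith [hm.1, hm.2]
    have h6 : |inner ℝ p w| ≤ ‖V‖ / a₁ := by rwa [le_div_iff₀ ha₁0]
    rw [hc₁, one_div, inv_mul_eq_div, div_le_iff₀ (by positivity)]
    calc ‖w‖ ≤ ‖V‖ + |inner ℝ p w| * L := h5
      _ ≤ ‖V‖ + ‖V‖ / a₁ * L := by gcongr
      _ = ‖V‖ * (1 + L / a₁) := by ring
  -- The first bound keeps collar points within `ζ / 2` of the sphere; the second makes `e` small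
  -- compared with `ζ` there.
  set η := min (ζ / 2) (ζ / (16 * (L + 1))) with hη
  have hη0 : 0 < η := lt_min (by positivity) (by positivity)
  -- Chosen so that varying the cutoff costs at most a quarter of `c₂`.
  set κ := c₂ / (8 * (L + 1)) with hκ
  have hκ0 : 0 < κ := by positivity
  have hκL : 2 * L * κ ≤ c₂ / 4 := by
    rw [hκ, mul_div_assoc', div_le_div_iff₀ (by positivity) (by positivity)]
    nlinarith
  have hηL : 2 * (L * η) ≤ ζ / 8 := by
    have h1 : L * η ≤ L * (ζ / (16 * (L + 1))) := mul_le_mul_of_nonneg_left (min_le_right _ _) hL.le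
    have h2 : L * (ζ / (16 * (L + 1))) ≤ ζ / 16 := by
      rw [mul_div_assoc', div_le_div_iff₀ (by positivity) (by positivity)]
      nlinarith
    linarith
  refine ⟨η, hη0, κ, hκ0, c₂ / 2, by positivity, fun m hm hmη hmκ => ?_⟩
  -- By symmetry `y` is the point nearer to the sphere. The variation of `m` is then multiplied by
  -- `e y`, of size at most `L * (1 - ‖y‖ ^ 2)`, which is the weight in the hypothesis on `m`.
  have main : ∀ x ∈ B4, ∀ y ∈ B4, ‖x‖ ≤ ‖y‖ →
      c₂ / 2 * ‖x - y‖ ≤ ‖(x + m x • e x) - (y + m y • e y)‖ := by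
    intro x hx y hy hxy
    have hx1 : ‖x‖ ≤ 1 := by simpa using hx
    have hy1 : ‖y‖ ≤ 1 := by simpa using hy
    have hsplit : (x + m x • e x) - (y + m y • e y) =
        ((x - y) + m x • (e x - e y)) + (m x - m y) • e y := by
      simp only [smul_sub, sub_smul]; abel
    have herr : ‖(m x - m y) • e y‖ ≤ c₂ / 4 * ‖x - y‖ := by
      rcases (show 0 ≤ 1 - ‖y‖ ^ 2 by nlinarith [norm_nonneg y]).eq_or_lt with h | h
      · have : ‖y‖ = 1 := by nlinarith [norm_nonneg y]
        rw [he0 y this, smul_zero, norm_zero]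
        positivity
      · have h1 := hmκ x hx y hy h hxy
        have h2 : ‖y‖ - ‖x‖ ≤ ‖x - y‖ := by
          rw [norm_sub_rev]; exact norm_sub_norm_le y x
        have h3 : ‖y‖ ^ 2 - ‖x‖ ^ 2 ≤ 2 * ‖x - y‖ := by nlinarith [norm_nonneg x, norm_nonneg y]
        rw [norm_smul, Real.norm_eq_abs]
        calc |m x - m y| * ‖e y‖ ≤ |m x - m y| * (L * (1 - ‖y‖ ^ 2)) :=
              mul_le_mul_of_nonneg_left (heu y hy) (abs_nonneg _)
          _ = L * (|m x - m y| * (1 - ‖y‖ ^ 2)) := by ring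
          _ ≤ L * (κ * (2 * ‖x - y‖)) := by
              refine mul_le_mul_of_nonneg_left (h1.trans ?_) hL.le
              exact mul_le_mul_of_nonneg_left h3 hκ0.le
          _ = 2 * L * κ * ‖x - y‖ := by ring
          _ ≤ c₂ / 4 * ‖x - y‖ := mul_le_mul_of_nonneg_right hκL (norm_nonneg _)
    have hmain : 3 * c₂ / 4 * ‖x - y‖ ≤ ‖(x - y) + m x • (e x - e y)‖ := by
      -- Three cases: `x` is deep, where `m x = m₀`; both points are in the collar but far apart,
      -- where `e` is negligible; both are in the collar and close together, where `e` is nearly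
      -- linear.
      by_cases hdx : η ≤ 1 - ‖x‖ ^ 2
      · rw [hmη x hx hdx]
        refine le_trans ?_ (hdeep x hx y hy)
        exact mul_le_mul_of_nonneg_right (by linarith) (norm_nonneg _)
      push Not at hdx
      have hdy : 1 - ‖y‖ ^ 2 < η := by nlinarith [norm_nonneg x, norm_nonneg y]
      by_cases hfar : ζ / 2 ≤ ‖x - y‖
      · have h1 : ‖m x • (e x - e y)‖ ≤ ζ / 8 := by
          have h2 : ‖e x‖ ≤ L * η := (heu x hx).trans (mul_le_mul_of_nonneg_left hdx.le hL.le)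
          have h3 : ‖e y‖ ≤ L * η := (heu y hy).trans (mul_le_mul_of_nonneg_left hdy.le hL.le)
          have h4 : ‖e x - e y‖ ≤ ‖e x‖ + ‖e y‖ := norm_sub_le _ _
          rw [norm_smul, Real.norm_of_nonneg (hm x hx).1]
          have h5 := mul_le_mul_of_nonneg_right (hm x hx).2 (norm_nonneg (e x - e y))
          linarith
        have h2 : ‖x - y‖ - ‖m x • (e x - e y)‖ ≤ ‖(x - y) + m x • (e x - e y)‖ := by
          have := norm_sub_norm_le (x - y) (-(m x • (e x - e y)))
          rwa [norm_neg, sub_neg_eq_add] at this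
        have h3 : c₂ * ‖x - y‖ ≤ ‖x - y‖ := mul_le_of_le_one_left (norm_nonneg _) hc₂₂
        linarith
      -- The derivative is frozen at a point `p` of the sphere near `x`; uniform continuity of the
      -- derivative bounds the error on a convex set containing both points.
      · push Not at hfar
        obtain ⟨p, hp, hxp⟩ := exists_unit_vector_near hx1
        have hpB : p ∈ B4 := by simp [hp]
        have hxp' : ‖x - p‖ < ζ / 2 := (hxp.trans_lt hdx).trans_le (min_le_left _ _)
        have hyp' : ‖y - p‖ < ζ := by
          have h1 : y - p = (x - p) - (x - y) := by abel
          rw [h1]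
          exact (norm_sub_le _ _).trans_lt (by linarith)
        have hconv : Convex ℝ (B4 ∩ ball p ζ) := (convex_closedBall _ _).inter (convex_ball _ _)
        have h1 : ‖e x - e y - fderivWithin ℝ e B4 p (x - y)‖ ≤ c₂ / 4 * ‖x - y‖ := by
          refine hconv.norm_image_sub_le_of_norm_hasFDerivWithin_le'
            (f' := fun z => fderivWithin ℝ e B4 z) (fun z hz => ?_) (fun z hz => ?_)
            ⟨hy, by rwa [mem_ball, dist_eq_norm]⟩ ⟨hx, by rw [mem_ball, dist_eq_norm]; linarith⟩
          · exact ((he.differentiableOn (by simp) z hz.1).hasFDerivWithinAt).mono inter_subset_left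
          · have := hunif z hz.1 p hpB hz.2
            rw [dist_eq_norm] at this
            exact this.le
        have h2 := hT p (x - y) hp (m x) (hm x hx)
        have h3 : (x - y) + m x • (e x - e y) =
            ((x - y) + m x • fderivWithin ℝ e B4 p (x - y)) -
              (-(m x • (e x - e y - fderivWithin ℝ e B4 p (x - y)))) := by
          simp only [smul_sub]; abel
        have h4 : ‖m x • (e x - e y - fderivWithin ℝ e B4 p (x - y))‖ ≤ c₂ / 4 * ‖x - y‖ := by
          rw [norm_smul, Real.norm_of_nonneg (hm x hx).1]
          exact (mul_le_of_le_one_left (norm_nonneg _) (hm x hx).2).trans h1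
        have h5 := norm_sub_norm_le ((x - y) + m x • fderivWithin ℝ e B4 p (x - y))
          (-(m x • (e x - e y - fderivWithin ℝ e B4 p (x - y))))
        rw [← h3, norm_neg] at h5
        have h6 : c₂ * ‖x - y‖ ≤ c₁ * ‖x - y‖ := mul_le_mul_of_nonneg_right hc₂₁ (norm_nonneg _)
        linarith
    rw [hsplit]
    have h1 := norm_sub_norm_le ((x - y) + m x • (e x - e y)) (-((m x - m y) • e y))
    rw [norm_neg, sub_neg_eq_add] at h1
    linarith
  intro x hx y hy
  rcases le_total ‖x‖ ‖y‖ with h | h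
  · exact main x hx y hy h
  · rw [norm_sub_rev x y, norm_sub_rev (x + m x • e x)]
    exact main y hy x hx h

/-! ### Diffeomorphisms of the ball, and isotopy rel boundary as a relation. -/

/-- `f` is a diffeomorphism of `B⁴` with inverse `g`. -/
structure IsBallDiffeo (f g : E4 → E4) : Prop where
  mapsTo : MapsTo f B4 B4
  mapsTo_inv : MapsTo g B4 B4
  left_inv : LeftInvOn g f B4
  right_inv : RightInvOn g f B4
  smooth : ContDiffOn ℝ ∞ f B4
  smooth_inv : ContDiffOn ℝ ∞ g B4

namespace IsBallDiffeo

variable {f g f' g' : E4 → E4}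

theorem symm (h : IsBallDiffeo f g) : IsBallDiffeo g f :=
  ⟨h.mapsTo_inv, h.mapsTo, h.right_inv, h.left_inv, h.smooth_inv, h.smooth⟩

theorem comp (h : IsBallDiffeo f g) (h' : IsBallDiffeo f' g') :
    IsBallDiffeo (f ∘ f') (g' ∘ g) where
  mapsTo := h.mapsTo.comp h'.mapsTo
  mapsTo_inv := h'.mapsTo_inv.comp h.mapsTo_inv
  left_inv := h'.left_inv.comp h.left_inv h'.mapsTo
  right_inv := h'.right_inv.comp h.right_inv h.mapsTo_inv
  smooth := h.smooth.comp h'.smooth h'.mapsTo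
  smooth_inv := h'.smooth_inv.comp h.smooth_inv h.mapsTo_inv

theorem norm_lt_one (h : IsBallDiffeo f g) {x : E4} (hx : ‖x‖ < 1) : ‖f x‖ < 1 :=
  norm_lt_one_of_leftInvOn h.smooth h.smooth_inv h.mapsTo h.left_inv hx

end IsBallDiffeo

theorem BallIsotopy.isBallDiffeo (F : BallIsotopy) {t : ℝ} (ht : t ∈ Icc (0 : ℝ) 1) :
    IsBallDiffeo (F.toFun t) (F.invFun t) :=
  ⟨F.mapsTo t ht, F.mapsTo_inv t ht, F.left_inv t ht, F.right_inv t ht, F.contDiffOn_toFun ht,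
    F.contDiffOn_invFun ht⟩

namespace AmbientlyIsotopicRelBoundary

theorem symm {S T : Set E4} (hS : S ⊆ B4) (h : AmbientlyIsotopicRelBoundary S T) :
    AmbientlyIsotopicRelBoundary T S := by
  obtain ⟨F, hF, hc⟩ := h
  refine ⟨⟨F.invFun, F.toFun, F.mapsTo_inv, F.mapsTo, F.right_inv, F.left_inv, F.smooth_inv,
    F.smooth, fun x hx => ?_⟩, fun t ht x => ?_, ?_⟩
  · have := F.left_inv 0 (by simp) hx
    rwa [F.map_zero x hx] at this
  · have := F.left_inv t ht (sphere_subset_closedBall x.2)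
    rwa [hF t ht x] at this
  · have hc' : F.toFun 1 '' S = T := hc
    change F.invFun 1 '' T = S
    rw [← hc']
    exact ((F.left_inv 1 (by simp)).mono hS).image_image

theorem trans {S T U : Set E4} (h : AmbientlyIsotopicRelBoundary S T)
    (h' : AmbientlyIsotopicRelBoundary T U) : AmbientlyIsotopicRelBoundary S U := by
  obtain ⟨F, hF, hc⟩ := h
  obtain ⟨G, hG, hd⟩ := h'
  refine ⟨⟨fun t => G.toFun t ∘ F.toFun t, fun t => F.invFun t ∘ G.invFun t,
    fun t ht => ((G.isBallDiffeo ht).comp (F.isBallDiffeo ht)).mapsTo,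
    fun t ht => ((G.isBallDiffeo ht).comp (F.isBallDiffeo ht)).mapsTo_inv,
    fun t ht => ((G.isBallDiffeo ht).comp (F.isBallDiffeo ht)).left_inv,
    fun t ht => ((G.isBallDiffeo ht).comp (F.isBallDiffeo ht)).right_inv,
    G.smooth.comp (contDiffOn_fst.prodMk F.smooth) fun p hp => ⟨hp.1, F.mapsTo _ hp.1 hp.2⟩,
    F.smooth_inv.comp (contDiffOn_fst.prodMk G.smooth_inv)
      fun p hp => ⟨hp.1, G.mapsTo_inv _ hp.1 hp.2⟩, fun x hx => ?_⟩, fun t ht x => ?_, ?_⟩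
  · simp only [Function.comp_apply]
    rw [F.map_zero x hx, G.map_zero x hx]
  · simp only [Function.comp_apply]
    rw [hF t ht x, hG t ht x]
  · have hc' : F.toFun 1 '' S = T := hc
    have hd' : G.toFun 1 '' T = U := hd
    change (G.toFun 1 ∘ F.toFun 1) '' S = U
    rw [image_comp, hc', hd']

end AmbientlyIsotopicRelBoundary

/-! ### Making a diffeomorphism the identity near the sphere. -/

theorem norm_sub_smul_self {p : E4} (hp : ‖p‖ = 1) {s : ℝ} (hs : s ∈ Icc (0 : ℝ) 1) :
    ‖p - s • p‖ = 1 - s := by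
  have : p - s • p = (1 - s) • p := by rw [sub_smul, one_smul]
  rw [this, norm_smul, hp, Real.norm_of_nonneg (by linarith [hs.2]), mul_one]

theorem sub_smul_mem_B4 {p : E4} (hp : ‖p‖ = 1) {s : ℝ} (hs : s ∈ Icc (0 : ℝ) 1) :
    p - s • p ∈ B4 := by
  rw [mem_closedBall_zero_iff, norm_sub_smul_self hp hs]
  linarith [hs.1]

/-- The one-sided difference quotient along the inward radius at `p`, paired with `p`, gives the
bound on the normal derivative. -/
theorem le_inner_fderivWithin {f : E4 → E4} {A : E4 →L[ℝ] E4} {p : E4} (hp : ‖p‖ = 1)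
    (hfp : f p = p) (hf : HasFDerivWithinAt f A B4 p) {c : ℝ}
    (hc : ∀ s ∈ Icc (0 : ℝ) 1, inner ℝ p (f (p - s • p)) ≤ 1 - c * s) : c ≤ inner ℝ p (A p) := by
  have hline : HasDerivWithinAt (fun s : ℝ => p - s • p) (-p) (Icc 0 1) 0 := by
    simpa using (((hasDerivAt_id (0 : ℝ)).smul_const p).const_sub p).hasDerivWithinAt
  have hf0 : HasFDerivWithinAt f A B4 (p - (0 : ℝ) • p) := by rwa [zero_smul, sub_zero]
  have hfl : HasDerivWithinAt (fun s : ℝ => f (p - s • p)) (A (-p)) (Icc 0 1) 0 :=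
    HasFDerivWithinAt.comp_hasDerivWithinAt (t := B4) (0 : ℝ) hf0 hline
      fun s hs => sub_smul_mem_B4 hp hs
  have hin : HasDerivWithinAt (fun s : ℝ => innerSL ℝ p (f (p - s • p)))
      (innerSL ℝ p (A (-p))) (Ioi 0) 0 :=
    ((innerSL ℝ p).hasFDerivAt.comp_hasDerivWithinAt (0 : ℝ) hfl).mono_of_mem_nhdsWithin
      (Icc_mem_nhdsGT zero_lt_one)
  have h5 := (hasDerivWithinAt_iff_tendsto_slope' (by simp)).1 hin
  have h6 : innerSL ℝ p (A (-p)) ≤ -c := by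
    refine le_of_tendsto h5 ?_
    filter_upwards [Ioc_mem_nhdsGT (zero_lt_one' ℝ)] with s hs
    have h9 := hc s ⟨hs.1.le, hs.2⟩
    rw [slope_def_field]
    simp only [zero_smul, sub_zero, hfp, innerSL_apply_apply, real_inner_self_eq_norm_sq, hp]
    rw [div_le_iff₀ hs.1]
    linarith
  rw [map_neg, innerSL_apply_apply, inner_neg_right] at h6
  linarith

/-- At a point of the sphere, a diffeomorphism of the ball that fixes the sphere pointwise stretches
the normal direction by a factor bounded below. -/
theorem le_one_add_inner_fderivWithin {f : E4 → E4} (hf : ContDiffOn ℝ ∞ f B4)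
    (hfm : MapsTo f B4 B4) (hS : ∀ x, ‖x‖ = 1 → f x = x) {c : ℝ} (hc : 0 < c)
    (hlow : ∀ x ∈ B4, ∀ y ∈ B4, c * ‖x - y‖ ≤ ‖f x - f y‖) {p : E4} (hp : ‖p‖ = 1) :
    c ≤ 1 + inner ℝ p (fderivWithin ℝ (fun x => f x - x) B4 p p) := by
  have hpB : p ∈ B4 := by simp [hp]
  have he : ContDiffOn ℝ ∞ (fun x => f x - x) B4 := hf.sub contDiffOn_id
  set De := fderivWithin ℝ (fun x => f x - x) B4 p with hDe
  have hfd : HasFDerivWithinAt f (De + ContinuousLinearMap.id ℝ E4) B4 p := by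
    have h1 := (he.differentiableOn (by simp) p hpB).hasFDerivWithinAt.add (hasFDerivWithinAt_id p B4)
    refine h1.congr (fun x _ => ?_) ?_ <;> simp
  set α := inner ℝ p (De p) with hα
  -- Since `De` kills the tangential vector `t`, the derivative of `f` sends `p - t` to `(1 + α) •
  -- p`. As `‖p - t‖ ≥ 1`, the lower bound gives `c ≤ |1 + α|`; the sign is positive because `f`
  -- maps the ball into itself.
  set t := De p - α • p with ht
  have hpt : inner ℝ p t = 0 := by
    rw [ht, inner_sub_right, inner_smul_right, real_inner_self_eq_norm_sq, hp, ← hα]; ring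
  have hDt : De t = 0 :=
    fderivWithin_apply_of_inner_eq_zero he (fun x hx => by simp [hS x hx]) hp hpt
  have h1 : (De + ContinuousLinearMap.id ℝ E4) (p - t) = (1 + α) • p := by
    simp only [_root_.add_apply, ContinuousLinearMap.id_apply, map_sub, hDt]
    rw [ht, add_smul, one_smul]; abel
  have h2 := le_norm_apply_of_lower_bound hpB hfd (fun y hy => hlow y hy p hpB) (p - t)
  rw [h1, norm_smul, hp, mul_one, Real.norm_eq_abs] at h2
  have h3 : 1 ≤ ‖p - t‖ := by
    have := real_inner_le_norm p (p - t)
    rwa [inner_sub_right, hpt, real_inner_self_eq_norm_sq, hp, one_mul, one_pow, sub_zero] at this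
  have h4 : 0 ≤ 1 + α := by
    have := le_inner_fderivWithin hp (hS p hp) hfd (c := 0) fun s hs => by
      have h8 : ‖f (p - s • p)‖ ≤ 1 := by simpa using hfm (sub_smul_mem_B4 hp hs)
      have h9 := real_inner_le_norm p (f (p - s • p))
      rw [hp, one_mul] at h9
      linarith
    rwa [_root_.add_apply, ContinuousLinearMap.id_apply, inner_add_right,
      real_inner_self_eq_norm_sq, hp, one_pow, ← hα, add_comm] at this
  rw [abs_of_nonneg h4] at h2
  nlinarith

theorem norm_add_smul_sub_lt_one {x y : E4} (hx : ‖x‖ < 1) (hy : ‖y‖ < 1) {m : ℝ}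
    (hm : m ∈ Icc (0 : ℝ) 1) : ‖x + m • (y - x)‖ < 1 := by
  have := (convex_ball (0 : E4) 1).add_smul_sub_mem (x := x) (y := y) (by simpa using hx)
    (by simpa using hy) hm
  simpa using this

/-- A diffeomorphism of the ball that fixes the sphere pointwise is isotopic rel boundary to one
that is the identity near the sphere. -/
theorem IsBallDiffeo.exists_isotopy_to_id_near_sphere {f g : E4 → E4} (h : IsBallDiffeo f g)
    (hS : ∀ x, ‖x‖ = 1 → f x = x) :
    ∃ H : BallIsotopy, H.IsRelBoundary ∧ ∃ δ > 0, ∀ x ∈ B4, 1 - ‖x‖ ^ 2 < δ →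
      H.toFun 1 (f x) = x := by
  obtain ⟨L, hL, -, hLip⟩ := exists_lipschitz_on_B4 h.smooth_inv
  have hlow : ∀ x ∈ B4, ∀ y ∈ B4, L⁻¹ * ‖x - y‖ ≤ ‖f x - f y‖ := by
    intro x hx y hy
    have := hLip (f x) (h.mapsTo hx) (f y) (h.mapsTo hy)
    rw [h.left_inv hx, h.left_inv hy] at this
    rwa [inv_mul_le_iff₀ hL]
  set e : E4 → E4 := fun x => f x - x with he
  have hes : ContDiffOn ℝ ∞ e B4 := h.smooth.sub contDiffOn_id
  obtain ⟨η, hη, κ, hκ, c, hc, hmain⟩ := lower_bound_of_slow_cutoff hes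
    (fun x hx => by simp [he, hS x hx]) (m₀ := 1) (inv_pos.2 hL) (fun x hx y hy => by
      have : (x - y) + (1 : ℝ) • (e x - e y) = f x - f y := by
        simp only [he, one_smul]; abel
      rw [this]
      exact hlow x hx y hy) (inv_pos.2 hL)
    (fun p hp => le_one_add_inner_fderivWithin h.smooth h.mapsTo hS (inv_pos.2 hL) hlow hp)
  obtain ⟨l, δ, hδ, hls, hl01, hl0, hl1, hlκ⟩ := exists_slow_cutoff hη hκ
  -- At `s = 0` the factor is `1`, so `Ψ 0 = f`; at `s = 1` it is the cutoff, which vanishes near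
  -- the sphere. Away from the collar it is `1` for all `s`, whence `m₀ = 1`.
  set m : ℝ → E4 → ℝ := fun s x => l (1 - ‖x‖ ^ 2) + (1 - l (1 - ‖x‖ ^ 2)) * (1 - s) with hm
  have hm01 : ∀ s ∈ Icc (0 : ℝ) 1, ∀ x, m s x ∈ Icc (0 : ℝ) 1 := by
    intro s hs x
    have h1 := hl01 (1 - ‖x‖ ^ 2)
    constructor
    · simp only [hm]; nlinarith [h1.1, h1.2, hs.1, hs.2]
    · simp only [hm]; nlinarith [h1.1, h1.2, hs.1, hs.2]
  set Ψ : ℝ → E4 → E4 := fun s x => x + m s x • e x with hΨ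
  have hΨs : ContDiffOn ℝ ∞ (fun p : ℝ × E4 => Ψ p.1 p.2) (Icc (0 : ℝ) 1 ×ˢ B4) := by
    have hl' : ContDiff ℝ ∞ (fun p : ℝ × E4 => l (1 - ‖p.2‖ ^ 2)) :=
      hls.comp (contDiff_const.sub (contDiff_snd.norm_sq ℝ))
    have hm' : ContDiff ℝ ∞ (fun p : ℝ × E4 => m p.1 p.2) :=
      hl'.add ((contDiff_const.sub hl').mul (contDiff_const.sub contDiff_fst))
    exact contDiffOn_snd.add (hm'.contDiffOn.smul (hes.comp contDiffOn_snd fun p hp => hp.2))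
  have hΨS : ∀ t ∈ Icc (0 : ℝ) 1, ∀ x, ‖x‖ = 1 → Ψ t x = x := fun t _ x hx => by
    simp [hΨ, he, hS x hx]
  obtain ⟨Ψ', h1, h2, h3, h4, h5⟩ := exists_smooth_inverse_family hΨs hΨS
    (fun t ht x hx => norm_add_smul_sub_lt_one hx (h.norm_lt_one hx) (hm01 t ht x)) hc
    (fun t ht => by
      refine hmain (m t) (fun x _ => hm01 t ht x) (fun x _ hx => by simp [hm, hl1 _ hx]) ?_
      intro x hx y hy hy0 hxy
      have hab : 1 - ‖y‖ ^ 2 ≤ 1 - ‖x‖ ^ 2 := by nlinarith [norm_nonneg x]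
      have h6 := hlκ _ _ hy0 hab
      have h7 : m t x - m t y = t * (l (1 - ‖x‖ ^ 2) - l (1 - ‖y‖ ^ 2)) := by
        simp only [hm]; ring
      have h8 : |m t x - m t y| ≤ |l (1 - ‖x‖ ^ 2) - l (1 - ‖y‖ ^ 2)| := by
        rw [h7, abs_mul, abs_of_nonneg ht.1]
        exact mul_le_of_le_one_left (abs_nonneg _) ht.2
      have h9 := mul_le_mul_of_nonneg_right h8 hy0.le
      linarith)
  -- Composing with `g` makes the isotopy start at the identity and end at `Ψ 1 ∘ f⁻¹`.
  refine ⟨⟨fun t => Ψ t ∘ g, fun t => f ∘ Ψ' t, fun t ht => (h1 t ht).comp h.mapsTo_inv,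
    fun t ht => h.mapsTo.comp (h2 t ht), fun t ht => h.symm.left_inv.comp (h3 t ht) h.mapsTo_inv,
    fun t ht => h.symm.right_inv.comp (h4 t ht) (h2 t ht), ?_, ?_, ?_⟩, ?_, δ, hδ, ?_⟩
  · exact hΨs.comp (contDiffOn_fst.prodMk (h.smooth_inv.comp contDiffOn_snd fun p hp => hp.2))
      fun p hp => ⟨hp.1, h.mapsTo_inv hp.2⟩
  · exact h.smooth.comp h5 fun p hp => h2 _ hp.1 hp.2
  · intro x hx
    have : Ψ 0 (g x) = f (g x) := by simp [hΨ, hm, he]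
    rw [Function.comp_apply, this, h.right_inv hx]
  · intro t ht x
    have hx : ‖(x : E4)‖ = 1 := norm_eq_of_mem_sphere x
    have hgx : g x = x := by
      have := h.left_inv (sphere_subset_closedBall x.2)
      rwa [hS _ hx] at this
    change Ψ t (g x) = x
    rw [hgx, hΨS t ht x hx]
  · intro x hx hxδ
    change Ψ 1 (g (f x)) = x
    rw [h.left_inv hx]
    simp [hΨ, hm, hl0 _ hxδ]

/-! ### The commutator trick. -/

theorem contDiff_piecewise_id {f : E4 → E4} (hf : ContDiffOn ℝ ∞ f B4) {δ : ℝ} (hδ : 0 < δ)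
    (hfδ : ∀ x ∈ B4, 1 - ‖x‖ ^ 2 < δ → f x = x) :
    ContDiff ℝ ∞ (fun x => if ‖x‖ ≤ 1 then f x else x) := by
  rw [contDiff_iff_contDiffAt]
  intro x
  by_cases hx : ‖x‖ < 1
  · have hN : ball (0 : E4) 1 ∈ 𝓝 x := isOpen_ball.mem_nhds (by simpa using hx)
    refine (hf.contDiffAt (mem_of_superset hN ball_subset_closedBall)).congr_of_eventuallyEq ?_
    filter_upwards [hN] with z hz
    have : ‖z‖ < 1 := by simpa using hz
    simp [this.le]
  · have h1 : ∀ᶠ z in 𝓝 x, 1 - ‖z‖ ^ 2 < δ := by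
      refine ContinuousAt.eventually_lt (by fun_prop) (by fun_prop) ?_
      push Not at hx
      nlinarith
    refine contDiffAt_id.congr_of_eventuallyEq (h1.mono fun z hz => ?_)
    by_cases hz1 : ‖z‖ ≤ 1
    · simp [hz1, hfδ z (by simpa using hz1) hz]
    · simp [hz1]

/-- A diffeomorphism of the ball that is the identity near the sphere can be isotoped into a small
ball which misses a given set. -/
theorem IsBallDiffeo.isotopic_image_of_eq_id_near_sphere {f g : E4 → E4} (h : IsBallDiffeo f g)
    {δ : ℝ} (hδ : 0 < δ) (hfδ : ∀ x ∈ B4, 1 - ‖x‖ ^ 2 < δ → f x = x) {S : Set E4} (hSB : S ⊆ B4)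
    {p : E4} {ε : ℝ} (hε : 0 < ε) (hpε : closedBall p ε ⊆ ball 0 1)
    (hdisj : Disjoint (closedBall p ε) S) : AmbientlyIsotopicRelBoundary (f '' S) S := by
  have hgδ : ∀ x ∈ B4, 1 - ‖x‖ ^ 2 < δ → g x = x := by
    intro x hx hxδ
    have := h.left_inv hx
    rwa [hfδ x hx hxδ] at this
  -- Extension by the identity to all of `ℝ⁴` is needed because the inverse shrinkings map points of
  -- the ball outside it.
  set φ : E4 → E4 := fun x => if ‖x‖ ≤ 1 then f x else x with hφ
  set γ : E4 → E4 := fun x => if ‖x‖ ≤ 1 then g x else x with hγ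
  have hφs : ContDiff ℝ ∞ φ := contDiff_piecewise_id h.smooth hδ hfδ
  have hγs : ContDiff ℝ ∞ γ := contDiff_piecewise_id h.smooth_inv hδ hgδ
  have hφB : ∀ x ∈ B4, φ x = f x := fun x hx => by
    have : ‖x‖ ≤ 1 := by simpa using hx
    simp [hφ, this]
  have hγB : ∀ x ∈ B4, γ x = g x := fun x hx => by
    have : ‖x‖ ≤ 1 := by simpa using hx
    simp [hγ, this]
  have hφ1 : ∀ x, 1 ≤ ‖x‖ → φ x = x := by
    intro x hx
    by_cases hx1 : ‖x‖ ≤ 1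
    · have hxB : x ∈ B4 := by simpa using hx1
      rw [hφB x hxB]
      exact hfδ x hxB (by nlinarith)
    · simp [hφ, hx1]
  have hγ1 : ∀ x, 1 ≤ ‖x‖ → γ x = x := by
    intro x hx
    by_cases hx1 : ‖x‖ ≤ 1
    · have hxB : x ∈ B4 := by simpa using hx1
      rw [hγB x hxB]
      exact hgδ x hxB (by nlinarith)
    · simp [hγ, hx1]
  have hγφ : ∀ x, γ (φ x) = x := by
    intro x
    by_cases hx : ‖x‖ ≤ 1
    · have hxB : x ∈ B4 := by simpa using hx
      rw [hφB x hxB, hγB _ (h.mapsTo hxB), h.left_inv hxB]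
    · push Not at hx
      rw [hφ1 x hx.le, hγ1 x hx.le]
  have hφγ : ∀ x, φ (γ x) = x := by
    intro x
    by_cases hx : ‖x‖ ≤ 1
    · have hxB : x ∈ B4 := by simpa using hx
      rw [hγB x hxB, hφB _ (h.mapsTo_inv hxB), h.right_inv hxB]
    · push Not at hx
      rw [hγ1 x hx.le, hφ1 x hx.le]
  set r : ℝ → ℝ := fun t => 1 - t + t * ε with hr
  have hr0 : ∀ t ∈ Icc (0 : ℝ) 1, 0 < r t := by
    intro t ht
    simp only [hr]
    rcases ht.2.eq_or_lt with h1 | h1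
    · rw [h1]; linarith
    · have := mul_nonneg ht.1 hε.le
      linarith
  -- The straight-line homotopy from the identity to the similarity `x ↦ p + ε • x`; it keeps the
  -- ball in itself.
  set J : ℝ → E4 → E4 := fun t x => t • p + r t • x with hJ
  set J' : ℝ → E4 → E4 := fun t y => (r t)⁻¹ • (y - t • p) with hJ'
  have hJJ' : ∀ t ∈ Icc (0 : ℝ) 1, ∀ y, J t (J' t y) = y := by
    intro t ht y
    simp only [hJ, hJ', smul_smul, mul_inv_cancel₀ (hr0 t ht).ne', one_smul]
    abel
  have hJ'J : ∀ t ∈ Icc (0 : ℝ) 1, ∀ y, J' t (J t y) = y := by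
    intro t ht y
    simp only [hJ, hJ', add_sub_cancel_left, smul_smul, inv_mul_cancel₀ (hr0 t ht).ne', one_smul]
  have hJconv : ∀ t x, J t x = (1 - t) • x + t • (p + ε • x) := by
    intro t x
    simp only [hJ, hr, smul_add, add_smul, smul_smul]
    abel
  have hJlt : ∀ t ∈ Icc (0 : ℝ) 1, ∀ x, ‖x‖ < 1 → ‖J t x‖ < 1 := by
    intro t ht x hx
    have h1 : p + ε • x ∈ ball (0 : E4) 1 := by
      refine hpε ?_
      rw [mem_closedBall, dist_eq_norm, add_sub_cancel_left, norm_smul, Real.norm_of_nonneg hε.le]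
      nlinarith
    have h2 := convex_ball (0 : E4) 1 (by simpa using hx : x ∈ ball (0 : E4) 1) h1
      (sub_nonneg.2 ht.2) ht.1 (by ring)
    rw [hJconv]
    simpa using h2
  have hJle : ∀ t ∈ Icc (0 : ℝ) 1, ∀ x, ‖x‖ ≤ 1 → ‖J t x‖ ≤ 1 := by
    intro t ht x hx
    have h1 : p + ε • x ∈ closedBall (0 : E4) 1 := by
      refine ball_subset_closedBall (hpε ?_)
      rw [mem_closedBall, dist_eq_norm, add_sub_cancel_left, norm_smul, Real.norm_of_nonneg hε.le]
      nlinarith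
    have h2 := convex_closedBall (0 : E4) 1 (by simpa using hx : x ∈ closedBall (0 : E4) 1) h1
      (sub_nonneg.2 ht.2) ht.1 (by ring)
    rw [hJconv]
    simpa using h2
  have hrs : ContDiff ℝ ∞ (fun q : ℝ × E4 => r q.1) := by
    simp only [hr]; fun_prop
  have hJs : ContDiff ℝ ∞ (fun q : ℝ × E4 => J q.1 q.2) := by
    simp only [hJ, hr]; fun_prop
  have hJ's : ContDiffOn ℝ ∞ (fun q : ℝ × E4 => J' q.1 q.2) (Icc (0 : ℝ) 1 ×ˢ univ) := by
    refine ContDiffOn.smul (hrs.contDiffOn.inv fun q hq => (hr0 q.1 hq.1).ne') ?_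
    exact (contDiff_snd.sub (contDiff_fst.smul contDiff_const)).contDiffOn
  have conj_smooth : ∀ θ : E4 → E4, ContDiff ℝ ∞ θ →
      ContDiffOn ℝ ∞ (fun q : ℝ × E4 => J q.1 (θ (J' q.1 q.2))) (Icc (0 : ℝ) 1 ×ˢ univ) :=
    fun θ hθ => hJs.comp_contDiffOn (contDiffOn_fst.prodMk (hθ.comp_contDiffOn hJ's))
  have conj_maps : ∀ θ : E4 → E4, MapsTo θ B4 B4 → (∀ x, 1 ≤ ‖x‖ → θ x = x) →
      ∀ t ∈ Icc (0 : ℝ) 1, MapsTo (fun y => J t (θ (J' t y))) B4 B4 := by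
    intro θ hθ hθ1 t ht y hy
    by_cases hz : ‖J' t y‖ ≤ 1
    · have h1 : θ (J' t y) ∈ B4 := hθ (by simpa using hz)
      simpa using hJle t ht _ (by simpa using h1)
    · push Not at hz
      simp only
      rw [hθ1 _ hz.le, hJJ' t ht]
      exact hy
  have hφm : MapsTo φ B4 B4 := fun x hx => by rw [hφB x hx]; exact h.mapsTo hx
  have hγm : MapsTo γ B4 B4 := fun x hx => by rw [hγB x hx]; exact h.mapsTo_inv hx
  -- The commutator of `J t` and `φ`, trivial at `t = 0`. At `t = 1` the factor `J φ J⁻¹` is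
  -- supported in the small ball, which misses `S`, so on `f '' S` only the inverse of `f` acts.
  refine ⟨⟨fun t y => J t (φ (J' t (γ y))), fun t y => φ (J t (γ (J' t y))),
    fun t ht => (conj_maps φ hφm hφ1 t ht).comp hγm,
    fun t ht => hφm.comp (conj_maps γ hγm hγ1 t ht), fun t ht x _ => ?_, fun t ht x _ => ?_,
    ?_, ?_, fun x _ => ?_⟩, fun t ht x => ?_, ?_⟩
  · simp only
    rw [hJ'J t ht, hγφ, hJJ' t ht, hφγ]
  · simp only
    rw [hγφ, hJ'J t ht, hφγ, hJJ' t ht]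
  · exact (conj_smooth φ hφs).comp (contDiffOn_fst.prodMk (hγs.comp_contDiffOn contDiffOn_snd))
      fun q hq => ⟨hq.1, mem_univ _⟩
  · exact hφs.comp_contDiffOn ((conj_smooth γ hγs).mono (prod_mono_right (subset_univ _)))
  · simp [hJ, hJ', hr, hφγ]
  · have hx : ‖(x : E4)‖ = 1 := norm_eq_of_mem_sphere x
    change J t (φ (J' t (γ x))) = x
    rw [hγ1 _ hx.ge, hφ1, hJJ' t ht]
    by_contra hlt
    push Not at hlt
    have := hJlt t ht _ hlt
    rw [hJJ' t ht, hx] at this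
    exact lt_irrefl _ this
  · change (fun y => J 1 (φ (J' 1 (γ y)))) '' (f '' S) = S
    rw [image_image]
    refine (image_congr fun x hx => ?_).trans (image_id S)
    have h1 : (1 : ℝ) ∈ Icc (0 : ℝ) 1 := by simp
    rw [← hφB x (hSB hx), hγφ, hφ1, hJJ' 1 h1, id]
    have hxp : x ∉ closedBall p ε := fun hxp => disjoint_left.1 hdisj hxp hx
    rw [mem_closedBall, dist_eq_norm, not_le] at hxp
    simp only [hJ', hr, one_smul]
    rw [norm_smul, norm_inv, Real.norm_of_nonneg (by linarith), inv_mul_eq_div, le_div_iff₀ (by linarith)]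
    linarith

/-- If `S` filled the open ball, a chart coordinate would vanish on an open set of `ℝ⁴`; compactness
of `S` turns one missed point into a missed ball. -/
theorem IsProperSurface.exists_closedBall_disjoint {S : Set E4} (hS : IsProperSurface S) :
    ∃ p : E4, ∃ ε > 0, closedBall p ε ⊆ ball 0 1 ∧ Disjoint (closedBall p ε) S := by
  obtain ⟨p, hp, hpS⟩ : ∃ p ∈ ball (0 : E4) 1, p ∉ S := by
    by_contra! hcon
    obtain ⟨φ, hφ, h0, hS'⟩ := hS.interior_chart 0 (hcon 0 (by simp)) (by simp)
    have hU : IsOpen (φ '' (φ.source ∩ ball 0 1)) :=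
      φ.isOpen_image_of_subset_source (φ.open_source.inter isOpen_ball) inter_subset_left
    have hmem : φ 0 ∈ φ '' (φ.source ∩ ball 0 1) := mem_image_of_mem _ ⟨h0, by simp⟩
    have hcont : ContinuousAt (fun t : ℝ => φ 0 + t • EuclideanSpace.single (2 : Fin 4) (1 : ℝ)) 0 := by
      fun_prop
    have h1 := hcont.preimage_mem_nhds (by simpa using hU.mem_nhds hmem)
    obtain ⟨t, ht, ht0⟩ := (𝓝[≠] (0 : ℝ)).nonempty_of_mem
      (inter_mem (mem_nhdsWithin_of_mem_nhds h1) self_mem_nhdsWithin)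
    obtain ⟨x, ⟨hx, hxb⟩, hxt⟩ := ht
    have h2 := ((hS' x hx).1 (hcon x hxb)).1
    have h3 := ((hS' 0 h0).1 (hcon 0 (by simp))).1
    rw [hxt] at h2
    simp [h3] at h2
    exact ht0 h2
  have hopen : IsOpen (ball (0 : E4) 1 \ S) := isOpen_ball.sdiff hS.isCompact.isClosed
  obtain ⟨ε, hε, hsub⟩ := Metric.nhds_basis_closedBall.mem_iff.1 (hopen.mem_nhds ⟨hp, hpS⟩)
  exact ⟨p, ε, hε, hsub.trans sdiff_subset, disjoint_left.2 fun x hx => (hsub hx).2⟩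

/-! ### Radial projection, and a smooth retraction to the knot. -/

theorem fact_finrank_E4 : Fact (Module.finrank ℝ E4 = 3 + 1) := ⟨by simp⟩

/-- The radial projection to the unit sphere. -/
def sphereProj (y : E4) : S3 :=
  -- An arbitrary value at the origin; multiplication by the norm hides it.
  if h : y = 0 then ⟨EuclideanSpace.single 0 1, by simp⟩ else
    ⟨‖y‖⁻¹ • y, by simp [norm_smul, inv_mul_cancel₀ (norm_ne_zero_iff.2 h)]⟩

theorem coe_sphereProj {y : E4} (hy : y ≠ 0) : (sphereProj y : E4) = ‖y‖⁻¹ • y := by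
  simp [sphereProj, hy]

theorem norm_smul_sphereProj (y : E4) : ‖y‖ • (sphereProj y : E4) = y := by
  by_cases hy : y = 0
  · simp [hy]
  · rw [coe_sphereProj hy, smul_smul, mul_inv_cancel₀ (norm_ne_zero_iff.2 hy), one_smul]

theorem sphereProj_smul_coe {r : ℝ} (hr : 0 < r) (x : S3) : sphereProj (r • (x : E4)) = x := by
  have hx : ‖(x : E4)‖ = 1 := norm_eq_of_mem_sphere x
  have h0 : r • (x : E4) ≠ 0 := smul_ne_zero hr.ne' (norm_ne_zero_iff.1 (by simp [hx]))
  refine Subtype.ext ?_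
  rw [coe_sphereProj h0, norm_smul, hx, Real.norm_of_nonneg hr.le, mul_one, smul_smul,
    inv_mul_cancel₀ hr.ne', one_smul]

theorem sphereProj_coe (x : S3) : sphereProj (x : E4) = x := by
  simpa using sphereProj_smul_coe one_pos x

theorem contMDiffOn_sphereProj :
    ContMDiffOn 𝓘(ℝ, E4) (𝓡 3) ∞ sphereProj {0}ᶜ := by
  intro x hx
  have hx0 : 0 < ‖x‖ := norm_pos_iff.2 hx
  let χ : ContDiffBump x := ⟨‖x‖ / 4, ‖x‖ / 2, by positivity, by linarith⟩
  -- A nowhere vanishing smooth map that agrees with the identity near `x`, so that its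
  -- normalization is a globally defined map to the sphere.
  set w : E4 → E4 := fun y => x + χ y • (y - x) with hw
  have hw0 : ∀ y, w y ≠ 0 := by
    intro y h0
    have h1 : ‖χ y • (y - x)‖ < ‖x‖ := by
      by_cases hy : y ∈ ball x (‖x‖ / 2)
      · rw [mem_ball, dist_eq_norm] at hy
        rw [norm_smul, Real.norm_of_nonneg χ.nonneg]
        exact (mul_le_of_le_one_left (norm_nonneg _) χ.le_one).trans_lt (by linarith)
      · have : χ y = 0 := χ.zero_of_le_dist (by simpa using hy)
        rw [this, zero_smul, norm_zero]
        exact hx0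
    have h2 : x = -(χ y • (y - x)) := eq_neg_of_add_eq_zero_left h0
    have h3 : ‖x‖ = ‖χ y • (y - x)‖ := by rw [← norm_neg (χ y • (y - x)), ← h2]
    linarith
  have hws : ContDiff ℝ ∞ w := contDiff_const.add (χ.contDiff.smul (contDiff_id.sub contDiff_const))
  have hn : ContDiff ℝ ∞ (fun y => ‖w y‖⁻¹ • w y) :=
    ((hws.norm ℝ hw0).inv fun y => norm_ne_zero_iff.2 (hw0 y)).smul hws
  have := fact_finrank_E4
  have hm : ContMDiff 𝓘(ℝ, E4) (𝓡 3) ∞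
      (codRestrict (fun y => ‖w y‖⁻¹ • w y) (sphere (0 : E4) 1) fun y => by
        simp [norm_smul, inv_mul_cancel₀ (norm_ne_zero_iff.2 (hw0 y))]) :=
    hn.contMDiff.codRestrict_sphere _
  refine ContMDiffAt.contMDiffWithinAt ((hm x).congr_of_eventuallyEq ?_)
  filter_upwards [χ.eventuallyEq_one, isOpen_compl_singleton.mem_nhds hx] with y hy hy0
  refine Subtype.ext ?_
  rw [coe_sphereProj hy0]
  simp only [hw, val_codRestrict_apply]
  rw [hy]
  simp

section

variable {E H M : Type*} [NormedAddCommGroup E] [NormedSpace ℝ E] [TopologicalSpace H]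
  {I : ModelWithCorners ℝ E H} [TopologicalSpace M] [ChartedSpace H M]

theorem contMDiffOn_sphere_of_coe {f : M → S3} {s : Set M}
    (hf : ContMDiffOn I 𝓘(ℝ, E4) ∞ (fun x => (f x : E4)) s) : ContMDiffOn I (𝓡 3) ∞ f s := by
  have h1 : ContMDiffOn I (𝓡 3) ∞ (fun x => sphereProj (f x : E4)) s :=
    contMDiffOn_sphereProj.comp hf fun x _ =>
      norm_ne_zero_iff.1 (by simp)
  exact h1.congr fun x _ => (sphereProj_coe _).symm

end

/-- The inverse of an embedding of the circle extends to a smooth map to the plane. -/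
theorem exists_smooth_left_inverse {γ : Circle → S3}
    (hγ : Manifold.IsSmoothEmbedding (𝓡 1) (𝓡 3) ∞ γ) :
    ∃ τ : S3 → ℂ, ContMDiff (𝓡 3) 𝓘(ℝ, ℂ) ∞ τ ∧ ∀ θ, τ (γ θ) = θ := by
  have hcoe : ContMDiff (𝓡 1) 𝓘(ℝ, ℂ) ∞ (fun θ : Circle => (θ : ℂ)) := by
    have : Fact (Module.finrank ℝ ℂ = 1 + 1) := finrank_real_complex_fact'
    exact contMDiff_coe_sphere (E := ℂ)
  have hcl : IsClosed (range γ) := (isCompact_range hγ.isEmbedding.continuous).isClosed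
  -- The prescribed values form convex sets, so a partition of unity reduces the problem to local
  -- extensions; near the knot, an immersion chart provides a projection to the parameter.
  have hloc : ∀ y : S3, ∃ U ∈ 𝓝 y, ∃ g : S3 → ℂ, ContMDiffOn (𝓡 3) 𝓘(ℝ, ℂ) ∞ g U ∧
      ∀ z ∈ U, g z ∈ {v : ℂ | ∀ θ, γ θ = z → v = θ} := by
    intro y
    by_cases hy : y ∈ range γ
    · obtain ⟨θ₀, rfl⟩ := hy
      have h := hγ.isImmersion.isImmersionAt θ₀
      set D := h.domChart.extend (𝓡 1)
      set C := h.codChart.extend (𝓡 3)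
      set π : S3 → EuclideanSpace ℝ (Fin 1) := fun z => (h.equiv.symm (C z)).1 with hπ
      have hCs : ContMDiffOn (𝓡 3) 𝓘(ℝ, EuclideanSpace ℝ (Fin 3)) ∞ C h.codChart.source :=
        h.codChart.contMDiffOn_extend h.codChart_mem_maximalAtlas
      have hDs : ContMDiffOn 𝓘(ℝ, EuclideanSpace ℝ (Fin 1)) (𝓡 1) ∞ D.symm D.target := by
        have := contMDiffOn_extend_symm h.domChart_mem_maximalAtlas
        rwa [← OpenPartialHomeomorph.extend_target'] at this
      have hDo : IsOpen D.target := h.domChart.isOpen_extend_target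
      have hπs : ContMDiffOn (𝓡 3) 𝓘(ℝ, EuclideanSpace ℝ (Fin 1)) ∞ π h.codChart.source := by
        have h1 : ContDiff ℝ ∞ (fun v => (h.equiv.symm v).1) :=
          contDiff_fst.comp h.equiv.symm.contDiff
        exact h1.contMDiff.comp_contMDiffOn hCs
      have hπγ : ∀ θ ∈ h.domChart.source, π (γ θ) = D θ := by
        intro θ hθ
        have h1 := h.writtenInCharts (D.map_source (by rwa [OpenPartialHomeomorph.extend_source]))
        simp only [Function.comp_apply] at h1
        rw [D.left_inv (by rwa [OpenPartialHomeomorph.extend_source])] at h1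
        simp only [hπ, C]
        rw [h1]
        simp [D]
      -- The topological embedding excludes other strands: a point of the knot in `V` has its
      -- parameter in the chart domain.
      obtain ⟨V, hVo, hV⟩ := hγ.isEmbedding.isInducing.isOpen_iff.1 h.domChart.open_source
      have hU : IsOpen (h.codChart.source ∩ π ⁻¹' D.target) :=
        hπs.continuousOn.isOpen_inter_preimage h.codChart.open_source hDo
      have hθ₀ : θ₀ ∈ γ ⁻¹' V := by rw [hV]; exact h.mem_domChart_source
      refine ⟨(h.codChart.source ∩ π ⁻¹' D.target) ∩ V, (hU.inter hVo).mem_nhds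
        ⟨⟨h.mem_codChart_source, ?_⟩, hθ₀⟩, fun z => (D.symm (π z) : Circle), ?_, ?_⟩
      · rw [mem_preimage, hπγ _ h.mem_domChart_source]
        exact D.map_source (by rw [OpenPartialHomeomorph.extend_source]; exact h.mem_domChart_source)
      · exact hcoe.comp_contMDiffOn
          (hDs.comp (hπs.mono fun z hz => hz.1.1) fun z hz => hz.1.2)
      · rintro z hz θ rfl
        have hθ : θ ∈ h.domChart.source := by rw [← hV]; exact hz.2
        simp only
        rw [hπγ θ hθ, D.left_inv (by rwa [OpenPartialHomeomorph.extend_source])]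
    · exact ⟨(range γ)ᶜ, hcl.isOpen_compl.mem_nhds hy, fun _ => 0, contMDiffOn_const,
        fun z hz θ hθ => absurd ⟨θ, hθ⟩ hz⟩
  have hconv : ∀ y : S3, Convex ℝ {v : ℂ | ∀ θ, γ θ = y → v = θ} := by
    intro y v hv w hw a b _ _ hab θ hθ
    rw [hv θ hθ, hw θ hθ, ← add_smul, hab, one_smul]
  obtain ⟨τ, hτ⟩ := exists_contMDiffMap_forall_mem_convex_of_local (𝓡 3) (n := ⊤) hconv hloc
  exact ⟨τ, τ.contMDiff, fun θ => hτ (γ θ) θ rfl⟩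

/-- `T` is a smooth function, defined away from the origin, that recovers the parameter on the
smoothly parametrized closed curve `γ`. -/
structure IsCircleCoordinate (γ : Circle → S3) (T : E4 → ℂ) : Prop where
  smooth_param : ∀ θ₀ : Circle, ContDiff ℝ ∞ (fun s : ℝ => (γ (θ₀ * Circle.exp s) : E4))
  smooth : ContDiffOn ℝ ∞ T {0}ᶜ
  apply_param : ∀ θ : Circle, T (γ θ) = θ

theorem IsKnot.exists_isCircleCoordinate {K : Set S3} (hK : IsKnot K) :
    ∃ γ T, IsCircleCoordinate γ T ∧ range γ = K := by
  obtain ⟨γ, hγ, hr⟩ := hK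
  obtain ⟨τ, hτ, hτγ⟩ := exists_smooth_left_inverse hγ
  have := fact_finrank_E4
  have hcoe : ContMDiff (𝓡 3) 𝓘(ℝ, E4) ∞ (fun x : S3 => (x : E4)) := contMDiff_coe_sphere
  refine ⟨γ, τ ∘ sphereProj, ⟨fun θ₀ => ?_, ?_, fun θ => ?_⟩, hr⟩
  · have h1 : (fun s : ℝ => (γ (θ₀ * Circle.exp s) : E4)) =
        fun s : ℝ => (γ (Circle.exp (Complex.arg θ₀ + s)) : E4) := by
      funext s
      rw [Circle.exp_add, Circle.exp_arg]
    rw [h1, ← contMDiff_iff_contDiff]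
    have h2 : ContMDiff 𝓘(ℝ, ℝ) 𝓘(ℝ, ℝ) ∞ (fun s : ℝ => Complex.arg θ₀ + s) :=
      (contDiff_const.add contDiff_id).contMDiff
    exact hcoe.comp (hγ.contMDiff.comp (contMDiff_circleExp.comp h2))
  · rw [← contMDiffOn_iff_contDiffOn]
    exact hτ.comp_contMDiffOn contMDiffOn_sphereProj
  · simp only [Function.comp_apply]
    rw [sphereProj_coe, hτγ]

/-- The retraction to a closed curve along the fibres of a circle-valued function. -/
def curveRetract (γ : Circle → S3) (T : E4 → ℂ) (y : E4) : S3 :=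
  -- This is `γ (T / |T|)` where `T` is nonzero.
  γ (Circle.exp (Complex.arg (T y)))

/-- The domain on which the retraction is smooth. -/
def retractDomain (T : E4 → ℂ) : Set E4 := {y | y ≠ 0 ∧ T y ≠ 0}

/-- Measuring the argument relative to `θ₀` moves the branch cut away from `θ₀`, so smoothness can
be checked near every point of the circle. -/
theorem circle_exp_arg_eq_mul {z : ℂ} (hz : z ≠ 0) (θ₀ : Circle) :
    Circle.exp (Complex.arg z) =
      θ₀ * Circle.exp (Complex.arg (z * (starRingEnd ℂ) (θ₀ : ℂ))) := by
  have key : ∀ w : ℂ, w ≠ 0 → ((Circle.exp (Complex.arg w) : Circle) : ℂ) = w / ‖w‖ := by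
    intro w hw
    have hn : (‖w‖ : ℂ) ≠ 0 := by simpa using hw
    rw [Circle.coe_exp, eq_div_iff hn, mul_comm]
    exact Complex.norm_mul_exp_arg_mul_I w
  have h0 : (starRingEnd ℂ) (θ₀ : ℂ) ≠ 0 := by simp
  refine Circle.ext ?_
  rw [Circle.coe_mul, key z hz, key _ (mul_ne_zero hz h0), norm_mul, RCLike.norm_conj,
    Circle.norm_coe, mul_one, ← mul_div_assoc]
  congr 1
  have h1 : (θ₀ : ℂ) * (starRingEnd ℂ) (θ₀ : ℂ) = 1 := by
    rw [Complex.mul_conj, Circle.normSq_coe]; simp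
  rw [mul_left_comm, h1, mul_one]

theorem contDiffAt_arg {z : ℂ} (hz : z ∈ Complex.slitPlane) : ContDiffAt ℝ ∞ Complex.arg z := by
  have h1 : ContDiffAt ℝ ∞ (fun w => (Complex.log w).im) z :=
    Complex.imCLM.contDiff.contDiffAt.comp z ((Complex.contDiffAt_log hz).restrict_scalars ℝ)
  simpa [Complex.log_im] using h1

namespace IsCircleCoordinate

variable {γ : Circle → S3} {T : E4 → ℂ}

theorem isOpen_retractDomain (h : IsCircleCoordinate γ T) : IsOpen (retractDomain T) :=
  h.smooth.continuousOn.isOpen_inter_preimage isOpen_compl_singleton isOpen_compl_singleton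

theorem param_mem_retractDomain (h : IsCircleCoordinate γ T) (θ : Circle) : (γ θ : E4) ∈ retractDomain T :=
  ⟨norm_ne_zero_iff.1 (by simp), by rw [h.apply_param]; simp⟩

theorem curveRetract_param (h : IsCircleCoordinate γ T) (θ : Circle) : curveRetract γ T (γ θ) = γ θ := by
  rw [curveRetract, h.apply_param, Circle.exp_arg]

theorem contDiffAt_arg_mul (h : IsCircleCoordinate γ T) {y : E4} (hy : y ≠ 0) {θ₀ : Circle}
    (hyθ : T y * (starRingEnd ℂ) (θ₀ : ℂ) ∈ Complex.slitPlane) :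
    ContDiffAt ℝ ∞ (fun z => Complex.arg (T z * (starRingEnd ℂ) (θ₀ : ℂ))) y :=
  ContDiffAt.comp (g := Complex.arg) (f := fun z => T z * (starRingEnd ℂ) (θ₀ : ℂ)) y
    (contDiffAt_arg hyθ) ((h.smooth.contDiffAt (isOpen_compl_singleton.mem_nhds hy)).mul
    contDiffAt_const)

theorem contDiffOn_curveRetract (h : IsCircleCoordinate γ T) :
    ContDiffOn ℝ ∞ (fun y => (curveRetract γ T y : E4)) (retractDomain T) := by
  intro y hy
  refine ContDiffAt.contDiffWithinAt ?_
  set θ₀ := Circle.exp (Complex.arg (T y)) with hθ₀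
  have hslit : T y * (starRingEnd ℂ) (θ₀ : ℂ) ∈ Complex.slitPlane := by
    have h1 : T y * (starRingEnd ℂ) (θ₀ : ℂ) = (‖T y‖ : ℂ) := by
      have h2 := Complex.norm_mul_exp_arg_mul_I (T y)
      rw [← Circle.coe_exp, ← hθ₀] at h2
      nth_rewrite 1 [← h2]
      rw [mul_assoc, Complex.mul_conj, Circle.normSq_coe]; simp
    rw [h1]
    exact Complex.ofReal_mem_slitPlane.2 (norm_pos_iff.2 hy.2)
  refine ((h.smooth_param θ₀).contDiffAt.comp y (h.contDiffAt_arg_mul hy.1 hslit)).congr_of_eventuallyEq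
    ?_
  filter_upwards [h.isOpen_retractDomain.mem_nhds hy] with z hz
  simp only [curveRetract, Function.comp_apply]
  rw [circle_exp_arg_eq_mul hz.2 θ₀]

end IsCircleCoordinate

/-! ### Boundary charts, and pushing a collar of the surface into the cone. -/

/-- In a boundary chart, the sphere is given by the vanishing of the first coordinate. -/
theorem chart_zero_eq_zero_iff {φ : OpenPartialHomeomorph E4 E4}
    (hB : ∀ x ∈ φ.source, x ∈ B4 ↔ 0 ≤ φ x 0) {x : E4} (hx : x ∈ φ.source) :
    φ x 0 = 0 ↔ ‖x‖ = 1 := by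
  have hint : x ∈ interior B4 ↔ ‖x‖ < 1 := by
    rw [interior_closedBall _ one_ne_zero, mem_ball_zero_iff]
  constructor
  · intro h0
    have hxB : ‖x‖ ≤ 1 := by simpa using (hB x hx).2 h0.ge
    refine hxB.eq_of_not_lt fun hlt => ?_
    -- Were `x` interior, the chart would map ball points onto a neighbourhood of `φ x`, including
    -- points with negative coordinate `0`.
    have hU : IsOpen (φ '' (φ.source ∩ ball 0 1)) :=
      φ.isOpen_image_of_subset_source (φ.open_source.inter isOpen_ball) inter_subset_left
    have hmem : φ x ∈ φ '' (φ.source ∩ ball 0 1) := mem_image_of_mem _ ⟨hx, by simpa using hlt⟩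
    have hcont : ContinuousAt (fun t : ℝ => φ x - t • EuclideanSpace.single (0 : Fin 4) (1 : ℝ)) 0 := by
      fun_prop
    have h1 := hcont.preimage_mem_nhds (by simpa using hU.mem_nhds hmem)
    obtain ⟨t, ht, ht0⟩ := (𝓝[>] (0 : ℝ)).nonempty_of_mem
      (inter_mem (mem_nhdsWithin_of_mem_nhds h1) self_mem_nhdsWithin)
    obtain ⟨z, ⟨hz, hzb⟩, hzt⟩ := ht
    have h2 := (hB z hz).1 (ball_subset_closedBall hzb)
    rw [hzt] at h2
    have ht0' : 0 < t := ht0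
    simp [h0] at h2
    linarith
  · intro h1
    refine le_antisymm (not_lt.1 fun hlt => ?_) ((hB x hx).1 (by simp [h1]))
    have hcont : ContinuousAt (fun z => φ z 0) x :=
      (EuclideanSpace.proj (0 : Fin 4) : E4 →L[ℝ] ℝ).continuous.continuousAt.comp
        (φ.continuousAt hx)
    have hN : B4 ∈ 𝓝 x := by
      filter_upwards [hcont.eventually (eventually_gt_nhds hlt), φ.open_source.mem_nhds hx] with z hz hzs
      exact (hB z hzs).2 hz.le
    rw [mem_interior_iff_mem_nhds.symm, hint] at hN
    linarith

theorem exists_lower_bound_of_isCompact {Z : Set E4} (hZ : IsCompact Z) (hZB : Z ⊆ B4)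
    (h : ∀ z ∈ Z, ‖z‖ ≠ 1) : ∃ δ, 0 < δ ∧ δ < 1 ∧ ∀ z ∈ Z, δ < 1 - ‖z‖ ^ 2 := by
  rcases Z.eq_empty_or_nonempty with rfl | hne
  · exact ⟨1 / 2, by norm_num, by norm_num, by simp⟩
  · obtain ⟨z₀, hz₀, hmax⟩ := hZ.exists_isMaxOn hne continuous_norm.continuousOn
    have h1 : ‖z₀‖ < 1 := lt_of_le_of_ne (by simpa using hZB hz₀) (h z₀ hz₀)
    have h2 : 0 < 1 - ‖z₀‖ ^ 2 := by nlinarith [norm_nonneg z₀]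
    refine ⟨(1 - ‖z₀‖ ^ 2) / 2, by positivity, by nlinarith [norm_nonneg z₀], fun z hz => ?_⟩
    have h3 : ‖z‖ ≤ ‖z₀‖ := hmax hz
    nlinarith [norm_nonneg z]

section Straighten

variable {γ : Circle → S3} {T : E4 → ℂ} {S : Set E4}

theorem eq_param_of_mem_of_norm_eq_one (hb : BoundedBy S (range γ)) {y : E4} (hy : y ∈ S)
    (hy1 : ‖y‖ = 1) : ∃ θ, (γ θ : E4) = y := by
  obtain ⟨θ, hθ⟩ := (hb ⟨y, by simpa using hy1⟩).1 hy
  exact ⟨θ, by rw [hθ]⟩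

theorem param_mem (hb : BoundedBy S (range γ)) (θ : Circle) : (γ θ : E4) ∈ S :=
  (hb (γ θ)).2 (mem_range_self θ)

theorem exists_collar_subset_retractDomain (h : IsCircleCoordinate γ T) (hS : IsProperSurface S)
    (hb : BoundedBy S (range γ)) :
    ∃ ε, 0 < ε ∧ ε < 1 ∧ ∀ y ∈ S, 1 - ‖y‖ ^ 2 ≤ ε → y ∈ retractDomain T := by
  obtain ⟨δ, h0, h1, hδ⟩ := exists_lower_bound_of_isCompact
    (hS.isCompact.diff h.isOpen_retractDomain) (sdiff_subset.trans hS.subset_ball) (by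
      rintro z ⟨hz, hzT⟩ hz1
      obtain ⟨θ, rfl⟩ := eq_param_of_mem_of_norm_eq_one hb hz hz1
      exact hzT (h.param_mem_retractDomain θ))
  refine ⟨δ, h0, h1, fun y hy hyδ => ?_⟩
  by_contra hcon
  exact absurd (hδ y ⟨hy, hcon⟩) (not_lt.2 hyδ)

/-- A smooth map that fixes the sphere pointwise and sends a collar of the boundary of the surface
into the cone on the knot. -/
theorem exists_conical_map (h : IsCircleCoordinate γ T) (hS : IsProperSurface S)
    (hb : BoundedBy S (range γ)) :
    ∃ d : E4 → E4, ContDiff ℝ ∞ d ∧ (∀ y, ‖y‖ = 1 → d y = y) ∧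
      ∃ ε, 0 < ε ∧ ε < 1 ∧ ∀ y ∈ S, 1 - ‖y‖ ^ 2 ≤ ε →
        d y = ‖y‖ • (curveRetract γ T y : E4) := by
  obtain ⟨ε, hε0, hε1, hε⟩ := exists_collar_subset_retractDomain h hS hb
  set W := retractDomain T with hW
  have hWo : IsOpen W := h.isOpen_retractDomain
  have hκ := h.contDiffOn_curveRetract
  have hcone : ContDiffOn ℝ ∞ (fun y => ‖y‖ • (curveRetract γ T y : E4)) W := by
    have hn : ContDiffOn ℝ ∞ (fun y : E4 => ‖y‖) W := fun y hy =>
      (contDiffAt_norm ℝ hy.1).contDiffWithinAt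
    exact hn.smul hκ
  -- Both requirements are affine in the value, so local solutions can be glued by a partition of
  -- unity.
  set t : E4 → Set E4 := fun y => {v | (y ∈ S → 1 - ‖y‖ ^ 2 ≤ ε →
    v = ‖y‖ • (curveRetract γ T y : E4)) ∧ (‖y‖ = 1 → v = y)} with ht
  have hconv : ∀ y, Convex ℝ (t y) := by
    rintro y v ⟨hv1, hv2⟩ w ⟨hw1, hw2⟩ a b _ _ hab
    refine ⟨fun h1 h2 => ?_, fun h1 => ?_⟩
    · rw [hv1 h1 h2, hw1 h1 h2, ← add_smul, hab, one_smul]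
    · rw [hv2 h1, hw2 h1, ← add_smul, hab, one_smul]
  have hloc : ∀ y : E4, ∃ U ∈ 𝓝 y, ∃ g : E4 → E4, ContMDiffOn 𝓘(ℝ, E4) 𝓘(ℝ, E4) ∞ g U ∧
      ∀ z ∈ U, g z ∈ t z := by
    intro y
    have hSc : IsClosed S := hS.isCompact.isClosed
    by_cases hy1 : ‖y‖ = 1
    · by_cases hyS : y ∈ S
      · obtain ⟨φ, hφ, hyφ, hφB, hφS⟩ := hS.boundary_chart y hyS hy1
        set e₀ : E4 := EuclideanSpace.single (0 : Fin 4) (1 : ℝ) with he₀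
        set P : E4 → E4 := fun v => v - v 0 • e₀ with hP
        have hP0 : ∀ v, P v 0 = 0 := fun v => by simp [hP, he₀]
        have hPi : ∀ v (i : Fin 4), i ≠ 0 → P v i = v i := fun v i hi => by
          simp [hP, he₀, hi]
        have hPid : ∀ v : E4, v 0 = 0 → P v = v := fun v hv => by simp [hP, hv]
        have hPs : ContDiff ℝ ∞ P := by
          simp only [hP]; fun_prop
        set V := φ.source ∩ φ ⁻¹' (P ⁻¹' φ.target) with hV
        have hVo : IsOpen V :=
          φ.isOpen_inter_preimage (φ.open_target.preimage hPs.continuous)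
        -- The chart projection to the sphere, taking `S` into the knot.
        set q : E4 → E4 := fun z => φ.symm (P (φ z)) with hq
        have hqs : ContDiffOn ℝ ∞ q V :=
          hφ.2.comp (hPs.comp_contDiffOn (hφ.1.mono inter_subset_left)) fun z hz => hz.2
        set U := W ∩ (V ∩ q ⁻¹' W) with hU
        have hUo : IsOpen U := hWo.inter (hqs.continuousOn.isOpen_inter_preimage hVo hWo)
        have hq1 : ∀ z ∈ φ.source, ‖z‖ = 1 → q z = z := fun z hz hz1 => by
          simp only [hq]
          rw [hPid _ ((chart_zero_eq_zero_iff hφB hz).2 hz1), φ.left_inv hz]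
        have hyW : y ∈ W := hε y hyS (by rw [hy1]; linarith)
        have hyU : y ∈ U := by
          refine ⟨hyW, ⟨hyφ, ?_⟩, ?_⟩
          · rw [mem_preimage, mem_preimage, hPid _ ((chart_zero_eq_zero_iff hφB hyφ).2 hy1)]
            exact φ.map_source hyφ
          · rw [mem_preimage, hq1 y hyφ hy1]
            exact hyW
        set a : E4 → E4 := fun z => ‖z‖ • (curveRetract γ T z : E4) - z with ha
        have has : ContDiffOn ℝ ∞ a W := hcone.sub contDiffOn_id
        -- With `a` the displacement into the cone, `z + a z - a (q z)` meets both requirements: on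
        -- `S` the point `q z` lies on the knot, where `a` vanishes; on the sphere `q z = z` and the
        -- two corrections cancel.
        refine ⟨U, hUo.mem_nhds hyU, fun z => z + a z - a (q z), ?_, fun z hz => ⟨?_, ?_⟩⟩
        · rw [contMDiffOn_iff_contDiffOn]
          exact (contDiffOn_id.add (has.mono fun z hz => hz.1)).sub
            (has.comp (hqs.mono fun z hz => hz.2.1) fun z hz => hz.2.2)
        · intro hzS _
          have hzs : z ∈ φ.source := hz.2.1.1
          obtain ⟨_, h2, h3⟩ := (hφS z hzs).1 hzS
          have hqz : q z ∈ φ.source := φ.map_target hz.2.1.2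
          have hφq : φ (q z) = P (φ z) := φ.right_inv hz.2.1.2
          have hqS : q z ∈ S := by
            refine (hφS _ hqz).2 ?_
            rw [hφq, hP0, hPi _ 2 (by decide), hPi _ 3 (by decide)]
            exact ⟨le_rfl, h2, h3⟩
          have hqn : ‖q z‖ = 1 := by
            refine (chart_zero_eq_zero_iff hφB hqz).1 ?_
            rw [hφq, hP0]
          obtain ⟨θ, hθ⟩ := eq_param_of_mem_of_norm_eq_one hb hqS hqn
          have haq : a (q z) = 0 := by
            simp only [ha]
            rw [hqn, one_smul, ← hθ, h.curveRetract_param, sub_self]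
          simp only
          rw [haq, sub_zero]
          simp [ha]
        · intro hz1
          simp only
          rw [hq1 z hz.2.1.1 hz1, add_sub_cancel_right]
      · exact ⟨Sᶜ, hSc.isOpen_compl.mem_nhds hyS, id, contMDiffOn_id,
          fun z hz => ⟨fun hzS => absurd hzS hz, fun _ => rfl⟩⟩
    · have hne : IsOpen {z : E4 | ‖z‖ ≠ 1} := isOpen_ne_fun continuous_norm continuous_const
      by_cases hyS : y ∈ S ∧ 1 - ‖y‖ ^ 2 ≤ ε
      · refine ⟨W ∩ {z | ‖z‖ ≠ 1}, (hWo.inter hne).mem_nhds ⟨hε y hyS.1 hyS.2, hy1⟩,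
          fun z => ‖z‖ • (curveRetract γ T z : E4), ?_, fun z hz => ⟨fun _ _ => rfl,
            fun hz1 => absurd hz1 hz.2⟩⟩
        rw [contMDiffOn_iff_contDiffOn]
        exact hcone.mono inter_subset_left
      · have hcl' : IsClosed {z : E4 | 1 - ‖z‖ ^ 2 ≤ ε} := isClosed_le (by fun_prop) (by fun_prop)
        have hcl : IsClosed {z | z ∈ S ∧ 1 - ‖z‖ ^ 2 ≤ ε} := hSc.inter hcl'
        exact ⟨{z | z ∈ S ∧ 1 - ‖z‖ ^ 2 ≤ ε}ᶜ ∩ {z | ‖z‖ ≠ 1},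
          (hcl.isOpen_compl.inter hne).mem_nhds ⟨hyS, hy1⟩, id, contMDiffOn_id,
          fun z hz => ⟨fun h1 h2 => absurd ⟨h1, h2⟩ hz.1, fun hz1 => absurd hz1 hz.2⟩⟩
  obtain ⟨d, hd⟩ := exists_contMDiffMap_forall_mem_convex_of_local 𝓘(ℝ, E4) (n := ⊤) hconv hloc
  exact ⟨d, contMDiff_iff_contDiff.1 d.contMDiff, fun y => (hd y).2, ε, hε0, hε1, fun y => (hd y).1⟩

end Straighten

/-! ### Fibres of the retraction in a collar of the surface. -/

section Straighten

variable {γ : Circle → S3} {T : E4 → ℂ} {S : Set E4}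

/-- The inverse chart maps the hyperplane `x₀ = 0` into the sphere, so its derivative maps that
hyperplane to tangent vectors. Hence `⟪p, ·⟫` is a multiple of coordinate `0` of the derivative of
`φ`, with nonzero factor because `⟪p, p⟫ = 1`. -/
theorem apply_zero_eq_zero_of_inner_eq_zero {φ : OpenPartialHomeomorph E4 E4}
    (hφ : IsSmoothChart φ) (hB : ∀ x ∈ φ.source, x ∈ B4 ↔ 0 ≤ φ x 0) {p v : E4}
    (hp : p ∈ φ.source) (hp1 : ‖p‖ = 1) (hv : inner ℝ p v = 0) : fderiv ℝ φ p v 0 = 0 := by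
  have hφd : HasFDerivAt φ (fderiv ℝ φ p) p :=
    ((hφ.1.contDiffAt (φ.open_source.mem_nhds hp)).differentiableAt (by simp)).hasFDerivAt
  have hψd : HasFDerivAt φ.symm (fderiv ℝ φ.symm (φ p)) (φ p) :=
    ((hφ.2.contDiffAt (φ.open_target.mem_nhds (φ.map_source hp))).differentiableAt
      (by simp)).hasFDerivAt
  have hφp : φ.symm (φ p) = p := φ.left_inv hp
  have hinv : ∀ u, fderiv ℝ φ.symm (φ p) (fderiv ℝ φ p u) = u := by
    have h1 : HasFDerivAt (φ.symm ∘ φ) (ContinuousLinearMap.id ℝ E4) p :=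
      (hasFDerivAt_id p).congr_of_eventuallyEq
        (Eventually.mono (φ.open_source.mem_nhds hp) fun z hz => φ.left_inv hz)
    exact fun u => DFunLike.congr_fun ((hψd.comp p hφd).unique h1) u
  have htan : ∀ w : E4, w 0 = 0 → inner ℝ p (fderiv ℝ φ.symm (φ p) w) = 0 := by
    intro w hw
    have hline : HasDerivAt (fun t : ℝ => φ p + t • w) w 0 := by
      simpa using ((hasDerivAt_id (0 : ℝ)).smul_const w).const_add (φ p)
    have hψ0 : HasFDerivAt φ.symm (fderiv ℝ φ.symm (φ p)) (φ p + (0 : ℝ) • w) := by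
      rwa [zero_smul, add_zero]
    have h1 := (hψ0.comp_hasDerivAt (0 : ℝ) hline).norm_sq
    have h2 : (fun t : ℝ => ‖(φ.symm ∘ fun t : ℝ => φ p + t • w) t‖ ^ 2) =ᶠ[𝓝 0] fun _ => 1 := by
      have hc : ContinuousAt (fun t : ℝ => φ p + t • w) 0 := hline.continuousAt
      have hm : ∀ᶠ t in 𝓝 (0 : ℝ), φ p + t • w ∈ φ.target :=
        hc.preimage_mem_nhds (φ.open_target.mem_nhds (by simpa using φ.map_source hp))
      refine hm.mono fun t ht => ?_
      have h3 := (chart_zero_eq_zero_iff hB (φ.map_target ht)).1 (by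
        rw [φ.right_inv ht]
        simp [hw, (chart_zero_eq_zero_iff hB hp).2 hp1])
      simp [h3]
    have h3 := (h1.congr_of_eventuallyEq h2.symm).unique (hasDerivAt_const (0 : ℝ) (1 : ℝ))
    simpa [hφp] using h3
  set e₀ : E4 := EuclideanSpace.single (0 : Fin 4) (1 : ℝ) with he₀
  have hdec : ∀ u, inner ℝ p u =
      fderiv ℝ φ p u 0 * inner ℝ p (fderiv ℝ φ.symm (φ p) e₀) := by
    intro u
    have h1 := htan (fderiv ℝ φ p u - fderiv ℝ φ p u 0 • e₀) (by simp [he₀])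
    rw [map_sub, hinv, map_smul, inner_sub_right, inner_smul_right, sub_eq_zero] at h1
    exact h1
  have h1 := hdec p
  rw [real_inner_self_eq_norm_sq, hp1] at h1
  have h2 := hdec v
  rw [hv] at h2
  refine (mul_eq_zero.1 h2.symm).resolve_right fun h0 => ?_
  rw [h0] at h1
  norm_num at h1

/-- Near a given point of the knot, each fibre of the retraction to the knot meets each small
sphere in the surface. -/
theorem eventually_exists_mem_fibre (h : IsCircleCoordinate γ T) (hS : IsProperSurface S)
    (hb : BoundedBy S (range γ)) (θ₀ : Circle) :
    ∀ᶠ q : ℝ × Circle in 𝓝 (1, θ₀), q.1 ≤ 1 →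
      ∃ y ∈ S, ‖y‖ = q.1 ∧ curveRetract γ T y = γ q.2 := by
  obtain ⟨p, hp⟩ : ∃ p : E4, p = γ θ₀ := ⟨_, rfl⟩
  have hp1 : ‖p‖ = 1 := by rw [hp]; exact norm_eq_of_mem_sphere _
  have hpS : p ∈ S := by rw [hp]; exact param_mem hb θ₀
  obtain ⟨φ, hφ, hpφ, hφB, hφS⟩ := hS.boundary_chart p hpS hp1
  have hφc : ContDiffAt ℝ ∞ φ p := hφ.1.contDiffAt (φ.open_source.mem_nhds hpφ)
  have hφd : HasFDerivAt φ (fderiv ℝ φ p) p := (hφc.differentiableAt (by simp)).hasFDerivAt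
  have hφp : φ.symm (φ p) = p := φ.left_inv hpφ
  set s : E4 → ℝ := fun y => Complex.arg (T y * (starRingEnd ℂ) (θ₀ : ℂ)) with hs
  have hunit : (θ₀ : ℂ) * (starRingEnd ℂ) (θ₀ : ℂ) = 1 := by
    rw [Complex.mul_conj, Circle.normSq_coe]; simp
  have hslit : T p * (starRingEnd ℂ) (θ₀ : ℂ) ∈ Complex.slitPlane := by
    rw [hp, h.apply_param, hunit]; exact Complex.one_mem_slitPlane
  have hpW : p ∈ retractDomain T := by rw [hp]; exact h.param_mem_retractDomain θ₀
  have hsc : ContDiffAt ℝ ∞ s p := h.contDiffAt_arg_mul hpW.1 hslit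
  have hret : ∀ y ∈ retractDomain T, curveRetract γ T y = γ (θ₀ * Circle.exp (s y)) := by
    intro y hy
    rw [curveRetract, circle_exp_arg_eq_mul hy.2 θ₀]
  -- The surface, the concentric spheres and the fibres are all given by values of `Θ`. Once its
  -- derivative at `p` is invertible, `Θ` is open there and every nearby prescribed value is
  -- attained.
  set Θ : E4 → ℝ × ℝ × ℝ × ℝ := fun y => (φ y 2, φ y 3, ‖y‖ ^ 2, s y) with hΘ
  have hcoord : ∀ i : Fin 4, ContDiffAt ℝ ∞ (fun y => φ y i) p := fun i =>
    (EuclideanSpace.proj i : E4 →L[ℝ] ℝ).contDiff.contDiffAt.comp p hφc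
  have hΘc : ContDiffAt ℝ ∞ Θ p :=
    (hcoord 2).prodMk ((hcoord 3).prodMk ((contDiff_norm_sq ℝ).contDiffAt.prodMk hsc))
  have hcoordd : ∀ i : Fin 4, HasFDerivAt (fun y => φ y i)
      ((EuclideanSpace.proj i : E4 →L[ℝ] ℝ) ∘L fderiv ℝ φ p) p := fun i =>
    (EuclideanSpace.proj i : E4 →L[ℝ] ℝ).hasFDerivAt.comp p hφd
  have hsd : HasFDerivAt s (fderiv ℝ s p) p := (hsc.differentiableAt (by simp)).hasFDerivAt
  have hnd : HasFDerivAt (fun y : E4 => ‖y‖ ^ 2) (2 • innerSL ℝ p) p :=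
    (hasStrictFDerivAt_norm_sq p).hasFDerivAt
  have hΘd := (hcoordd 2).prodMk ((hcoordd 3).prodMk (hnd.prodMk hsd))
  have hΘs : HasStrictFDerivAt Θ _ p := hΘc.hasStrictFDerivAt' hΘd (by simp)
  set A := ((EuclideanSpace.proj (2 : Fin 4) : E4 →L[ℝ] ℝ) ∘L fderiv ℝ φ p).prod
    (((EuclideanSpace.proj (3 : Fin 4) : E4 →L[ℝ] ℝ) ∘L fderiv ℝ φ p).prod
      ((2 • innerSL ℝ p).prod (fderiv ℝ s p))) with hA
  -- A kernel vector is tangent to the surface and to the sphere, hence is the velocity of a curve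
  -- in the knot. That curve is recovered from its parameter `s`, whose derivative along `v`
  -- vanishes, so `v = 0`.
  have hker : ∀ v, A v = 0 → v = 0 := by
    intro v hv
    have h2 : fderiv ℝ φ p v 2 = 0 := congrArg (fun z : ℝ × ℝ × ℝ × ℝ => z.1) hv
    have h3 : fderiv ℝ φ p v 3 = 0 := congrArg (fun z : ℝ × ℝ × ℝ × ℝ => z.2.1) hv
    have hn : inner ℝ p v = 0 := by
      have h4 : (2 • innerSL ℝ p) v = 0 := congrArg (fun z : ℝ × ℝ × ℝ × ℝ => z.2.2.1) hv
      simpa using h4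
    have hsv : fderiv ℝ s p v = 0 := congrArg (fun z : ℝ × ℝ × ℝ × ℝ => z.2.2.2) hv
    have h0 := apply_zero_eq_zero_of_inner_eq_zero hφ hφB hpφ hp1 hn
    set w := fderiv ℝ φ p v with hw
    have hψd : HasFDerivAt φ.symm (fderiv ℝ φ.symm (φ p)) (φ p) :=
      ((hφ.2.contDiffAt (φ.open_target.mem_nhds (φ.map_source hpφ))).differentiableAt
        (by simp)).hasFDerivAt
    have hline : HasDerivAt (fun t : ℝ => φ p + t • w) w 0 := by
      simpa using ((hasDerivAt_id (0 : ℝ)).smul_const w).const_add (φ p)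
    have hψ0 : HasFDerivAt φ.symm (fderiv ℝ φ.symm (φ p)) (φ p + (0 : ℝ) • w) := by
      rwa [zero_smul, add_zero]
    have hinv : fderiv ℝ φ.symm (φ p) w = v := by
      have h1 : HasFDerivAt (φ.symm ∘ φ) (ContinuousLinearMap.id ℝ E4) p :=
        (hasFDerivAt_id p).congr_of_eventuallyEq
          (Eventually.mono (φ.open_source.mem_nhds hpφ) fun z hz => φ.left_inv hz)
      exact DFunLike.congr_fun ((hψd.comp p hφd).unique h1) v
    have hcd : HasDerivAt (fun t : ℝ => φ.symm (φ p + t • w)) v 0 := by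
      have := hψ0.comp_hasDerivAt (0 : ℝ) hline
      rwa [hinv] at this
    have hcp : φ.symm (φ p + (0 : ℝ) • w) = p := by rw [zero_smul, add_zero, hφp]
    have hsd0 : HasFDerivAt s (fderiv ℝ s p) (φ.symm (φ p + (0 : ℝ) • w)) := by rwa [hcp]
    have hscd : HasDerivAt (fun t : ℝ => s (φ.symm (φ p + t • w))) 0 0 := by
      have := hsd0.comp_hasDerivAt (0 : ℝ) hcd
      rwa [hsv] at this
    have hΓ : DifferentiableAt ℝ (fun r : ℝ => (γ (θ₀ * Circle.exp r) : E4))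
        (s (φ.symm (φ p + (0 : ℝ) • w))) :=
      ((h.smooth_param θ₀).differentiable (by simp)) _
    have hcomp : HasDerivAt (fun t : ℝ => (γ (θ₀ * Circle.exp (s (φ.symm (φ p + t • w)))) : E4))
        0 0 := by
      have := hΓ.hasFDerivAt.comp_hasDerivAt (0 : ℝ) hscd
      rwa [map_zero] at this
    refine hcd.unique (hcomp.congr_of_eventuallyEq ?_)
    have hc : ContinuousAt (fun t : ℝ => φ p + t • w) 0 := hline.continuousAt
    have hm : ∀ᶠ t in 𝓝 (0 : ℝ), φ p + t • w ∈ φ.target :=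
      hc.preimage_mem_nhds (φ.open_target.mem_nhds (by simpa using φ.map_source hpφ))
    filter_upwards [hm] with t ht
    have hsrc := φ.map_target ht
    have hpz := (chart_zero_eq_zero_iff hφB hpφ).2 hp1
    have hps := (hφS p hpφ).1 hpS
    have hn1 := (chart_zero_eq_zero_iff hφB hsrc).1 (by rw [φ.right_inv ht]; simp [h0, hpz])
    have hmS := (hφS _ hsrc).2 (by
      rw [φ.right_inv ht]
      simp [h0, hpz, h2, h3, hps.2.1, hps.2.2])
    obtain ⟨θ, hθ⟩ := eq_param_of_mem_of_norm_eq_one hb hmS hn1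
    rw [← hret _ (by rw [← hθ]; exact h.param_mem_retractDomain θ), ← hθ, h.curveRetract_param]
  have hsurj : Function.Surjective A := by
    have hinj : Function.Injective (A : E4 →ₗ[ℝ] ℝ × ℝ × ℝ × ℝ) :=
      (injective_iff_map_eq_zero _).2 hker
    refine (LinearMap.injective_iff_surjective_of_finrank_eq_finrank ?_).1 hinj
    simp
  have hmap := hΘs.map_nhds_eq_of_surj (LinearMap.range_eq_top.2 hsurj)
  have hN : φ.source ∩ retractDomain T ∈ 𝓝 p :=
    inter_mem (φ.open_source.mem_nhds hpφ) (h.isOpen_retractDomain.mem_nhds hpW)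
  have himg : Θ '' (φ.source ∩ retractDomain T) ∈ 𝓝 (Θ p) := by
    rw [← hmap]; exact image_mem_map hN
  have hpar : ContinuousAt (fun q : ℝ × Circle => ((0 : ℝ), (0 : ℝ), q.1 ^ 2,
      Complex.arg ((q.2 : ℂ) * (starRingEnd ℂ) (θ₀ : ℂ)))) (1, θ₀) := by
    refine continuousAt_const.prodMk (continuousAt_const.prodMk (ContinuousAt.prodMk (by fun_prop) ?_))
    have h1 : ContinuousAt (fun q : ℝ × Circle => (q.2 : ℂ) * (starRingEnd ℂ) (θ₀ : ℂ)) (1, θ₀) := by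
      fun_prop
    refine ContinuousAt.comp (g := Complex.arg) (Complex.continuousAt_arg ?_) h1
    simp only
    rw [hunit]; exact Complex.one_mem_slitPlane
  have hval : Θ p = (0, 0, (1 : ℝ) ^ 2, Complex.arg ((θ₀ : ℂ) * (starRingEnd ℂ) (θ₀ : ℂ))) := by
    have hps := (hφS p hpφ).1 hpS
    simp only [hΘ, hs]
    rw [hps.2.1, hps.2.2, hp1, hp, h.apply_param]
  have hpre := hpar.preimage_mem_nhds (by rw [← hval]; exact himg)
  have hpos : ∀ᶠ q : ℝ × Circle in 𝓝 (1, θ₀), 0 < q.1 :=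
    continuousAt_fst.eventually (eventually_gt_nhds (show (0 : ℝ) < (1, θ₀).1 by norm_num))
  filter_upwards [hpre, hpos] with q hq hq0 hq1
  obtain ⟨y, ⟨hyφ, hyW⟩, hy⟩ := hq
  simp only [hΘ, Prod.mk.injEq] at hy
  obtain ⟨hy2, hy3, hyn, hys⟩ := hy
  have hyn' : ‖y‖ = q.1 := (sq_eq_sq₀ (norm_nonneg _) hq0.le).1 hyn
  refine ⟨y, (hφS y hyφ).2 ⟨(hφB y hyφ).1 (by simpa [hyn'] using hq1), hy2, hy3⟩, hyn', ?_⟩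
  rw [hret y hyW, hys]
  congr 1
  rw [← circle_exp_arg_eq_mul (by simp) θ₀, Circle.exp_arg]

/-- Compactness of the circle makes the width of the collar uniform in `θ`. -/
theorem exists_collar_fibres_nonempty (h : IsCircleCoordinate γ T) (hS : IsProperSurface S)
    (hb : BoundedBy S (range γ)) :
    ∃ δ > 0, ∀ r : ℝ, 1 - δ < r → r ≤ 1 → ∀ θ, ∃ y ∈ S, ‖y‖ = r ∧ curveRetract γ T y = γ θ := by
  have h1 : ∀ᶠ r : ℝ in 𝓝 1, ∀ θ ∈ (univ : Set Circle), r ≤ 1 →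
      ∃ y ∈ S, ‖y‖ = r ∧ curveRetract γ T y = γ θ :=
    isCompact_univ.eventually_forall_of_forall_eventually fun θ _ =>
      eventually_exists_mem_fibre h hS hb θ
  obtain ⟨δ, hδ, hball⟩ := Metric.eventually_nhds_iff.1 h1
  refine ⟨δ, hδ, fun r hr hr1 θ => hball ?_ θ (mem_univ _) hr1⟩
  rw [Real.dist_eq, abs_lt]
  constructor <;> linarith

end Straighten

/-! ### Straightening the surface near the sphere. -/

theorem norm_add_smul_sub_le {x y : E4} {r m : ℝ} (hx : ‖x‖ ≤ r) (hy : ‖y‖ ≤ r)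
    (hm : m ∈ Icc (0 : ℝ) 1) : ‖x + m • (y - x)‖ ≤ r := by
  have := (convex_closedBall (0 : E4) r).add_smul_sub_mem (x := x) (y := y) (by simpa using hx)
    (by simpa using hy) hm
  simpa using this

/-- A proper surface can be made radial near the sphere by a diffeomorphism of the ball that fixes
the sphere pointwise. -/
theorem exists_straightening {γ : Circle → S3} {T : E4 → ℂ} {S : Set E4}
    (h : IsCircleCoordinate γ T) (hS : IsProperSurface S) (hb : BoundedBy S (range γ)) :
    ∃ D D', IsBallDiffeo D D' ∧ (∀ x, ‖x‖ = 1 → D x = x) ∧ ∃ δ > 0, ∀ x ∈ B4, 1 - ‖x‖ ^ 2 < δ →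
      (x ∈ D '' S ↔ sphereProj x ∈ range γ) := by
  obtain ⟨d, hds, hdS, ε, hε0, hε1, hdε⟩ := exists_conical_map h hS hb
  obtain ⟨δ₁, hδ₁0, hδ₁1, hδ₁⟩ := exists_lower_bound_of_isCompact (Z := B4 ∩ {y | d y = 0})
    ((isCompact_closedBall _ _).inter_right (isClosed_eq hds.continuous continuous_const))
    inter_subset_left (by
      rintro z ⟨-, hz⟩ hz1
      have h0 : d z = 0 := hz
      rw [hdS z hz1] at h0
      simp [h0] at hz1)
  obtain ⟨l₁, δ₂, hδ₂, hl₁s, hl₁01, hl₁0, hl₁1, -⟩ :=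
    exists_slow_cutoff (η := δ₁ / 2) (κ := 1) (by positivity) one_pos
  -- Rescaled to preserve the norm, wherever `d` is nonzero; `l₁` removes the region where `d` may
  -- vanish.
  set dn : E4 → E4 := fun y => ‖y‖ • (‖d y‖⁻¹ • d y) with hdn
  have hdn_le : ∀ y, ‖dn y‖ ≤ ‖y‖ := by
    intro y
    simp only [hdn]
    rw [norm_smul, norm_norm, norm_smul, norm_inv, norm_norm]
    exact mul_le_of_le_one_right (norm_nonneg _) (inv_mul_le_one)
  set e : E4 → E4 := fun y => (1 - l₁ (1 - ‖y‖ ^ 2)) • (dn y - y) with he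
  have hu : ContDiff ℝ ∞ (fun y : E4 => 1 - ‖y‖ ^ 2) := contDiff_const.sub (contDiff_norm_sq ℝ)
  have hes : ContDiffOn ℝ ∞ e B4 := by
    intro y hy
    refine ContDiffAt.contDiffWithinAt ?_
    by_cases hyu : 1 - ‖y‖ ^ 2 < δ₁
    · have hy0 : y ≠ 0 := by
        rintro rfl
        norm_num at hyu
        linarith
      have hdy : d y ≠ 0 := fun h0 => lt_asymm (hδ₁ y ⟨hy, h0⟩) hyu
      have h1 : ContDiffAt ℝ ∞ dn y :=
        (contDiffAt_norm ℝ hy0).smul (((hds.contDiffAt.norm ℝ hdy).inv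
          (norm_ne_zero_iff.2 hdy)).smul hds.contDiffAt)
      exact ((contDiffAt_const.sub (hl₁s.comp hu).contDiffAt)).smul (h1.sub contDiffAt_id)
    · have h1 : ∀ᶠ z in 𝓝 y, δ₁ / 2 < 1 - ‖z‖ ^ 2 :=
        hu.continuous.continuousAt.eventually (eventually_gt_nhds (by linarith))
      refine (contDiffAt_const (c := (0 : E4))).congr_of_eventuallyEq (h1.mono fun z hz => ?_)
      simp [he, hl₁1 _ hz.le]
  have he0 : ∀ x, ‖x‖ = 1 → e x = 0 := fun x hx => by simp [he, hdn, hdS x hx, hx]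
  have hle : ∀ x, ∀ m ∈ Icc (0 : ℝ) 1, ‖x + m • e x‖ ≤ ‖x‖ := by
    intro x m hm
    simp only [he, smul_smul]
    have h1 := hl₁01 (1 - ‖x‖ ^ 2)
    refine norm_add_smul_sub_le le_rfl (hdn_le x) ⟨mul_nonneg hm.1 (by linarith [h1.2]), ?_⟩
    exact mul_le_one₀ hm.2 (by linarith [h1.2]) (by linarith [h1.1])
  -- Here `m₀ = 0`: deep inside, `D` is the identity. The normal derivative is at least `1` because
  -- `id + e` does not increase the norm.
  obtain ⟨η, hη, κ, hκ, c, hc, hmain⟩ := lower_bound_of_slow_cutoff hes he0 (m₀ := 0) one_pos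
    (fun x _ y _ => by simp) one_pos (fun p hp => by
      have hpB : p ∈ B4 := by simp [hp]
      have hfd := (hasFDerivWithinAt_id p B4).add
        (hes.differentiableOn (by simp) p hpB).hasFDerivWithinAt
      have h1 := le_inner_fderivWithin hp (by simp [he0 p hp]) hfd (c := 1) fun s hs => by
        have h2 := real_inner_le_norm p ((p - s • p) + (1 : ℝ) • e (p - s • p))
        have h3 := hle (p - s • p) 1 (by simp)
        rw [norm_sub_smul_self hp hs] at h3
        rw [hp, one_mul, one_smul] at h2
        rw [one_smul] at h3
        simpa using h2.trans h3
      simpa [inner_add_right, real_inner_self_eq_norm_sq, hp] using h1)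
  obtain ⟨l, δ₃, hδ₃, hls, hl01, hl0, hl1, hlκ⟩ := exists_slow_cutoff hη hκ
  set m : E4 → ℝ := fun x => 1 - l (1 - ‖x‖ ^ 2) with hm
  have hm01 : ∀ x, m x ∈ Icc (0 : ℝ) 1 := fun x =>
    ⟨by simp only [hm]; linarith [(hl01 (1 - ‖x‖ ^ 2)).2],
      by simp only [hm]; linarith [(hl01 (1 - ‖x‖ ^ 2)).1]⟩
  set D : E4 → E4 := fun x => x + m x • e x with hD
  have hDs : ContDiffOn ℝ ∞ D B4 :=
    contDiffOn_id.add (((contDiff_const.sub (hls.comp hu)).contDiffOn).smul hes)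
  have hDS : ∀ x, ‖x‖ = 1 → D x = x := fun x hx => by simp [hD, he0 x hx]
  have h0 : (0 : ℝ) ∈ Icc (0 : ℝ) 1 := by simp
  obtain ⟨D', h1, h2, h3, h4, h5⟩ := exists_smooth_inverse_family (Ψ := fun _ => D)
    (hDs.comp contDiffOn_snd fun p hp => hp.2) (fun _ _ => hDS)
    (fun _ _ x hx => (hle x (m x) (hm01 x)).trans_lt hx) hc (fun _ _ => by
      refine hmain m (fun x _ => hm01 x) (fun x _ hx => by simp [hm, hl1 _ hx]) ?_
      intro x hx y hy hy0 hxy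
      have h6 := hlκ _ _ hy0 (show 1 - ‖y‖ ^ 2 ≤ 1 - ‖x‖ ^ 2 by nlinarith [norm_nonneg x])
      have h7 : |m x - m y| = |l (1 - ‖x‖ ^ 2) - l (1 - ‖y‖ ^ 2)| := by
        simp only [hm]
        rw [abs_sub_comm]
        congr 1
        ring
      rw [h7]
      linarith)
  refine ⟨D, D' 0, ⟨h1 0 h0, h2 0 h0, h3 0 h0, h4 0 h0, hDs, h5.comp
    (contDiff_const.prodMk contDiff_id).contDiffOn fun x hx => ⟨h0, hx⟩⟩, hDS, ?_⟩
  obtain ⟨δ₄, hδ₄, hfib⟩ := exists_collar_fibres_nonempty h hS hb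
  have hcone : ∀ y ∈ S, 1 - ‖y‖ ^ 2 < δ₂ → 1 - ‖y‖ ^ 2 < δ₃ → 1 - ‖y‖ ^ 2 < ε →
      D y = ‖y‖ • (curveRetract γ T y : E4) := by
    intro y hy hy2 hy3 hyε
    have hy0 : 0 < ‖y‖ := norm_pos_iff.2 fun h0 => by
      rw [h0] at hyε
      norm_num at hyε
      linarith
    simp only [hD, hm, he]
    rw [hl0 _ hy3, hl₁0 _ hy2, sub_zero, one_smul, one_smul, add_sub_cancel]
    simp only [hdn]
    rw [hdε y hy hyε.le, norm_smul, norm_norm, norm_eq_of_mem_sphere, mul_one, smul_smul,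
      smul_smul]
    congr 1
    field_simp
  refine ⟨min (min δ₂ δ₃) (min ε δ₄), by positivity, fun x hx hxδ => ?_⟩
  have hx1 : ‖x‖ ≤ 1 := by simpa using hx
  have hx2 : 1 - ‖x‖ ^ 2 < δ₂ := hxδ.trans_le ((min_le_left _ _).trans (min_le_left _ _))
  have hx3 : 1 - ‖x‖ ^ 2 < δ₃ := hxδ.trans_le ((min_le_left _ _).trans (min_le_right _ _))
  have hxε : 1 - ‖x‖ ^ 2 < ε := hxδ.trans_le ((min_le_right _ _).trans (min_le_left _ _))
  have hx4 : 1 - ‖x‖ ^ 2 < δ₄ := hxδ.trans_le ((min_le_right _ _).trans (min_le_right _ _))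
  constructor
  · rintro ⟨y, hy, rfl⟩
    -- Since `D` does not increase the norm, a preimage of a collar point lies in the collar too.
    have hy1 : ‖D y‖ ≤ ‖y‖ := hle y (m y) (hm01 y)
    have hyu : 1 - ‖y‖ ^ 2 ≤ 1 - ‖D y‖ ^ 2 := by nlinarith [norm_nonneg (D y)]
    have hy0 : 0 < ‖y‖ := norm_pos_iff.2 fun h0 => by
      have h6 := hyu.trans_lt hxε
      rw [h0] at h6
      norm_num at h6
      linarith
    rw [hcone y hy (hyu.trans_lt hx2) (hyu.trans_lt hx3) (hyu.trans_lt hxε),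
      sphereProj_smul_coe hy0]
    exact mem_range_self _
  · rintro ⟨θ, hθ⟩
    -- Nonempty fibres are what make the image all of the cone in the collar, and not just a part of
    -- it.
    obtain ⟨y, hy, hyn, hyθ⟩ := hfib ‖x‖ (by nlinarith [norm_nonneg x]) hx1 θ
    refine ⟨y, hy, ?_⟩
    rw [hcone y hy (by rwa [hyn]) (by rwa [hyn]) (by rwa [hyn]), hyn, hyθ, hθ,
      norm_smul_sphereProj]

/-! ### Extending the boundary isotopy radially. -/

/-- The norm and the radial projection fail to be smooth only at the origin, near which `ρ = 1`
makes the map the identity. -/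
theorem contDiff_radial_family {k : ℝ → S3 → S3}
    (hk : ContMDiffOn (𝓘(ℝ, ℝ).prod (𝓡 3)) (𝓡 3) ∞ (fun p : ℝ × S3 => k p.1 p.2)
      (Icc (0 : ℝ) 1 ×ˢ univ)) (hk1 : ∀ x, k 1 x = x) {ρ : E4 → ℝ} (hρ : ContDiff ℝ ∞ ρ)
    (hρ01 : ∀ x, ρ x ∈ Icc (0 : ℝ) 1) (hρ0 : ∀ᶠ x in 𝓝 0, ρ x = 1) :
    ContDiff ℝ ∞ (fun x => ‖x‖ • (k (ρ x) (sphereProj x) : E4)) := by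
  rw [contDiff_iff_contDiffAt]
  intro x
  by_cases hx : x = 0
  · subst hx
    refine contDiffAt_id.congr_of_eventuallyEq (hρ0.mono fun z hz => ?_)
    simp only [hz, hk1, norm_smul_sphereProj, id]
  · have := fact_finrank_E4
    have hcoe : ContMDiff (𝓡 3) 𝓘(ℝ, E4) ∞ (fun x : S3 => (x : E4)) := contMDiff_coe_sphere
    have h1 : ContMDiffOn 𝓘(ℝ, E4) (𝓡 3) ∞ (fun x => k (ρ x) (sphereProj x)) {0}ᶜ :=
      hk.comp (hρ.contMDiff.contMDiffOn.prodMk contMDiffOn_sphereProj)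
        fun z _ => ⟨hρ01 z, mem_univ _⟩
    have h2 : ContDiffOn ℝ ∞ (fun x => (k (ρ x) (sphereProj x) : E4)) {0}ᶜ :=
      contMDiffOn_iff_contDiffOn.1 (hcoe.comp_contMDiffOn h1)
    exact (contDiffAt_norm ℝ hx).smul (h2.contDiffAt (isOpen_compl_singleton.mem_nhds hx))

/-- The inverse of a diffeomorphism of the pair `(S³, K)` that is isotopic to the identity extends
to a diffeomorphism of the ball that is supported near the sphere and preserves the norm as well as
the cone on `K`. -/
theorem IsIsotopicToId.exists_radial_extension {K : Set S3} {φ : Equiv.Perm S3}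
    (hφ : IsIsotopicToId K φ) {δ : ℝ} (hδ : 0 < δ) :
    ∃ G G', IsBallDiffeo G G' ∧ (∀ x : S3, G x = φ.symm x) ∧ (∀ x, ‖G x‖ = ‖x‖) ∧
      (∀ x, δ ≤ 1 - ‖x‖ ^ 2 → G x = x) ∧ ∀ x, sphereProj (G x) ∈ K ↔ sphereProj x ∈ K := by
  obtain ⟨g, hg, hg', hgK, hg0, hg1⟩ := hφ
  -- The bound `1 / 2` ensures that `ρ = 1` near the origin even when `δ` is large.
  set δ' := min δ (1 / 2) with hδ'
  have hδ'0 : 0 < δ' := lt_min hδ (by norm_num)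
  set ρ : E4 → ℝ := fun x => Real.smoothTransition ((1 - ‖x‖ ^ 2) / δ') with hρ
  have hρs : ContDiff ℝ ∞ ρ :=
    Real.smoothTransition.contDiff.comp ((contDiff_const.sub (contDiff_norm_sq ℝ)).div_const _)
  have hρ01 : ∀ x, ρ x ∈ Icc (0 : ℝ) 1 := fun x =>
    ⟨Real.smoothTransition.nonneg _, Real.smoothTransition.le_one _⟩
  have hρ1 : ∀ x, δ' ≤ 1 - ‖x‖ ^ 2 → ρ x = 1 := fun x hx =>
    Real.smoothTransition.one_of_one_le (by rwa [le_div_iff₀ hδ'0, one_mul])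
  have hρ0 : ∀ᶠ x in 𝓝 0, ρ x = 1 := by
    have hc : ContinuousAt (fun x : E4 => 1 - ‖x‖ ^ 2) 0 := by fun_prop
    have h1 : δ' < 1 - ‖(0 : E4)‖ ^ 2 := by
      have : δ' ≤ 1 / 2 := min_le_right _ _
      norm_num
      linarith
    exact (hc.eventually (eventually_gt_nhds h1)).mono fun x hx => hρ1 x (le_of_lt hx)
  have hρn : ∀ x y, ‖x‖ = ‖y‖ → ρ x = ρ y := fun x y hxy => by simp only [hρ]; rw [hxy]
  have hn : ∀ (x : E4) (y : S3), ‖‖x‖ • (y : E4)‖ = ‖x‖ := fun x y => by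
    rw [norm_smul, norm_norm, norm_eq_of_mem_sphere, mul_one]
  have hmaps : ∀ k : E4 → S3, MapsTo (fun x => ‖x‖ • (k x : E4)) B4 B4 := by
    intro k x hx
    rw [mem_closedBall_zero_iff, hn]
    simpa using hx
  have hinv : ∀ k k' : ℝ → S3 → S3, (∀ t x, k t (k' t x) = x) → ∀ x : E4,
      ‖‖x‖ • (k' (ρ x) (sphereProj x) : E4)‖ •
        (k (ρ (‖x‖ • (k' (ρ x) (sphereProj x) : E4)))
          (sphereProj (‖x‖ • (k' (ρ x) (sphereProj x) : E4))) : E4) = x := by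
    intro k k' hkk' x
    by_cases hx : x = 0
    · simp [hx]
    · rw [hn, hρn _ x (hn _ _), sphereProj_smul_coe (norm_pos_iff.2 hx), hkk',
        norm_smul_sphereProj]
  -- On each concentric sphere this is the inverse of one stage of the isotopy; every stage
  -- preserves `K`, hence the cone is preserved.
  refine ⟨fun x => ‖x‖ • ((g (ρ x)).symm (sphereProj x) : E4),
    fun x => ‖x‖ • (g (ρ x) (sphereProj x) : E4),
    ⟨hmaps _, hmaps _, fun x _ => hinv (fun t => g t) (fun t => (g t).symm) (by simp) x,
      fun x _ => hinv (fun t => (g t).symm) (fun t => g t) (by simp) x,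
      (contDiff_radial_family (k := fun t => (g t).symm) hg' (fun x => by rw [hg1]; rfl) hρs hρ01 hρ0).contDiffOn,
      (contDiff_radial_family (k := fun t => g t) hg (by simp [hg1]) hρs hρ01 hρ0).contDiffOn⟩,
    fun x => ?_, fun x => hn _ _, fun x hx => ?_, fun x => ?_⟩
  · have h1 : ρ x = 0 := by
      simp [hρ]
    simp only
    rw [h1, hg0, sphereProj_coe, norm_eq_of_mem_sphere, one_smul]
  · simp only
    rw [hρ1 x ((min_le_left _ _).trans hx), hg1]
    exact norm_smul_sphereProj x
  · by_cases hx : x = 0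
    · simp [hx]
    · simp only
      rw [sphereProj_smul_coe (norm_pos_iff.2 hx)]
      nth_rewrite 2 [← hgK (ρ x) (hρ01 x)]
      rw [mem_image_equiv]

/-! ### Assembling the isotopy rel boundary. -/

theorem BallIsotopy.boundaryMap_mem_diffPair (F : BallIsotopy) {K : Set S3} {S₀ S₁ : Set E4}
    (hS₀ : S₀ ⊆ B4) (hb₀ : BoundedBy S₀ K) (hb₁ : BoundedBy S₁ K) (hF : F.Carries S₀ S₁) :
    F.boundaryMap 1 ∈ DiffPair K := by
  have := fact_finrank_E4
  have hcoe : ContMDiff (𝓡 3) 𝓘(ℝ, E4) ∞ (fun x : S3 => (x : E4)) := contMDiff_coe_sphere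
  have h1 : (1 : ℝ) ∈ Icc (0 : ℝ) 1 := by simp
  have hF' : F.toFun 1 '' S₀ = S₁ := hF
  have hres : ∀ f : E4 → E4, ContDiffOn ℝ ∞ f B4 → ∀ φ : S3 → S3, (∀ x, (φ x : E4) = f x) →
      ContMDiff (𝓡 3) (𝓡 3) ∞ φ := by
    intro f hf φ hφ
    rw [← contMDiffOn_univ]
    refine contMDiffOn_sphere_of_coe ?_
    simp only [hφ]
    have hf' : ContMDiffOn 𝓘(ℝ, E4) 𝓘(ℝ, E4) ∞ f B4 := contMDiffOn_iff_contDiffOn.2 hf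
    have hm : MapsTo (fun x : S3 => (x : E4)) univ B4 := fun x _ => sphere_subset_closedBall x.2
    exact hf'.comp hcoe.contMDiffOn hm
  refine ⟨hres _ (F.contDiffOn_toFun h1) _ fun x => rfl,
    hres _ (F.contDiffOn_invFun h1) _ fun x => rfl, ?_⟩
  · ext y
    constructor
    · rintro ⟨x, hx, rfl⟩
      exact (hb₁ _).1 (hF' ▸ mem_image_of_mem _ ((hb₀ x).2 hx))
    · intro hy
      refine ⟨(F.boundaryMap 1).symm y, ?_, Equiv.apply_symm_apply _ _⟩
      refine (hb₀ _).1 ?_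
      have hyS := (hb₁ y).2 hy
      rw [← hF'] at hyS
      obtain ⟨z, hz, hzy⟩ := hyS
      have : (((F.boundaryMap 1).symm y : S3) : E4) = z := by
        change F.invFun 1 y = z
        rw [← hzy]
        exact F.left_inv 1 h1 (hS₀ hz)
      rwa [this]

theorem BallIsotopy.ambientlyIsotopicRelBoundary (F : BallIsotopy) {K : Set S3} (hK : IsKnot K)
    {S₀ S₁ : Set E4} (hS₀ : IsProperSurface S₀) (hS₁ : IsProperSurface S₁)
    (hb₁ : BoundedBy S₁ K) (hF : F.Carries S₀ S₁) (hiso : IsIsotopicToId K (F.boundaryMap 1)) :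
    AmbientlyIsotopicRelBoundary S₀ S₁ := by
  have h1 : (1 : ℝ) ∈ Icc (0 : ℝ) 1 := by simp
  have hF' : F.toFun 1 '' S₀ = S₁ := hF
  obtain ⟨γ, T, hγ, rfl⟩ := hK.exists_isCircleCoordinate
  obtain ⟨D, D', hD, hDS, δ, hδ, hcone⟩ := exists_straightening hγ hS₁ hb₁
  obtain ⟨G, G', hG, hGS, hGn, hGδ, hGK⟩ := hiso.exists_radial_extension hδ
  -- In the collar `D '' S₁` is the cone, which `G` preserves; elsewhere `G` is the identity.
  have hmem : ∀ x ∈ B4, G x ∈ D '' S₁ ↔ x ∈ D '' S₁ := by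
    intro x hx
    by_cases hxδ : δ ≤ 1 - ‖x‖ ^ 2
    · rw [hGδ x hxδ]
    · push Not at hxδ
      rw [hcone x hx hxδ, hcone (G x) (hG.mapsTo hx) (by rwa [hGn]), hGK]
  have hDS₁ : D '' S₁ ⊆ B4 := by
    rintro _ ⟨y, hy, rfl⟩
    exact hD.mapsTo (hS₁.subset_ball hy)
  have hGim : G '' (D '' S₁) = D '' S₁ := by
    refine Subset.antisymm ?_ fun x hx => ?_
    · rintro _ ⟨x, hx, rfl⟩
      exact (hmem x (hDS₁ hx)).2 hx
    · have hxB := hDS₁ hx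
      refine ⟨G' x, (hmem _ (hG.mapsTo_inv hxB)).1 ?_, hG.right_inv hxB⟩
      rwa [hG.right_inv hxB]
  have hΦ := hD.symm.comp (hG.comp (hD.comp (F.isBallDiffeo h1)))
  -- On the sphere `D` and `D'` are the identity and `G` undoes the boundary map of `F`.
  set Φ := D' ∘ G ∘ D ∘ F.toFun 1 with hΦdef
  have hΦim : Φ '' S₀ = S₁ := by
    rw [hΦdef, image_comp, image_comp, image_comp, hF', hGim]
    exact (hD.left_inv.mono hS₁.subset_ball).image_image
  have hΦS : ∀ x, ‖x‖ = 1 → Φ x = x := by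
    intro x hx
    have hx' : x ∈ sphere (0 : E4) 1 := by simpa using hx
    have h2 : F.toFun 1 x = ((F.boundaryMap 1 ⟨x, hx'⟩ : S3) : E4) := rfl
    have h3 : D' x = x := by
      have := hD.left_inv (sphere_subset_closedBall hx')
      rwa [hDS x hx] at this
    simp only [hΦdef, Function.comp_apply]
    rw [h2, hDS _ (norm_eq_of_mem_sphere _), hGS, Equiv.symm_apply_apply]
    exact h3
  obtain ⟨H, hH, δ', hδ', hHδ⟩ := hΦ.exists_isotopy_to_id_near_sphere hΦS
  obtain ⟨p, ε, hε, hpε, hdisj⟩ := hS₀.exists_closedBall_disjoint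
  -- `H.toFun 1 ∘ Φ` is the identity near the sphere, so the commutator trick relates the image of
  -- `S₀` to `S₀`, while `H` itself relates it to `S₁`.
  have h2 : AmbientlyIsotopicRelBoundary ((H.toFun 1 ∘ Φ) '' S₀) S₀ :=
    ((H.isBallDiffeo h1).comp hΦ).isotopic_image_of_eq_id_near_sphere hδ' hHδ hS₀.subset_ball hε
      hpε hdisj
  have h3 : AmbientlyIsotopicRelBoundary S₁ ((H.toFun 1 ∘ Φ) '' S₀) :=
    ⟨H, hH, by rw [image_comp, hΦim]; rfl⟩
  exact (h3.trans h2).symm hS₁.subset_ball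

end KnottedSurface

end

theorem propositionA1 (K : Set S3) (hK : IsKnot K) (S₀ S₁ : Set E4)
    (hS₀ : IsProperSurface S₀) (hS₁ : IsProperSurface S₁)
    (hb₀ : BoundedBy S₀ K) (hb₁ : BoundedBy S₁ K) :
    (∀ F : BallIsotopy, F.Carries S₀ S₁ → IsIsotopicToId K (F.boundaryMap 1) →
      AmbientlyIsotopicRelBoundary S₀ S₁) ∧
    (Subsingleton (SymmetryGroup K) → AmbientlyIsotopic S₀ S₁ →
      AmbientlyIsotopicRelBoundary S₀ S₁) := by
  refine ⟨fun F hF hiso => F.ambientlyIsotopicRelBoundary hK hS₀ hS₁ hb₁ hF hiso, ?_⟩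
  rintro hsub ⟨F, hF⟩
  have hmem := F.boundaryMap_mem_diffPair hS₀.subset_ball hb₀ hb₁ hF
  have hone : (⟨F.boundaryMap 1, hmem⟩ : DiffPair K) ∈ isotopicToIdSubgroup K :=
    (QuotientGroup.eq_one_iff _).1 (Subsingleton.elim _ _)
  exact F.ambientlyIsotopicRelBoundary hK hS₀ hS₁ hb₁ hF hone
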